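/- Let $\mathbb{T}^d = \mathbb{R}^d/\mathbb{Z}^d$. For a continuous autonomous vector field $u : \mathbb{T}^d \to \mathbb{R}^d$, a time $T > 0$ and a point $x \in \mathbb{T}^d$, a trajectory of $u$ on $[0,T]$ starting at $x$ is an absolutely continuous curve $\gamma : [0,T] \to \mathbb{T}^d$ with $\gamma(0) = x$ and $\dot\gamma(t) = u(\gamma(t))$ for all $t \in [0,T]$ (one-sided derivatives at the end points). Trajectories on $[0,T]$ from $x$ are not unique if at least two different ones exist. **Theorem.** Let $d \geq 3$ be an integer, and let $1 \leq p < d-1$, $0 < \alpha < 1$ and $T_0 > 0$ be real numbers. There exists an autonomous vector field $u \in W^{1,p}(\mathbb{T}^d, \mathbb{R}^d) \cap C^\alpha(\mathbb{T}^d, \mathbb{R}^d)$ that is divergence-free (in the sense of distributions) such that, for every $T \geq T_0$, the set of initial conditions $x \in \mathbb{T}^d$ from which the trajectories of $u$ on $[0,T]$ are not unique has full Lebesgue measure in $\mathbb{T}^d$. -/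

import Mathlib

open MeasureTheory Set
open scoped NNReal ENNReal ContDiff

noncomputable section

namespace SteadyFlow

/-- The `d`-dimensional torus `ℝ^d / ℤ^d`. Its `volume` is the Lebesgue measure, of total mass one. -/
abbrev Torus (d : ℕ) : Type := UnitAddTorus (Fin d)

/-- The Euclidean space `ℝ^d`. -/
abbrev Space (d : ℕ) : Type := EuclideanSpace ℝ (Fin d)

/-- The quotient map `ℝ^d → ℝ^d / ℤ^d`. -/
def toTorus {d : ℕ} (x : Space d) : Torus d := fun i => ((x i : ℝ) : UnitAddCircle)

/-- `φ ∈ C^∞(𝕋^d)`: the periodic function on `ℝ^d` that corresponds to `φ` is smooth. -/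
def IsSmooth {d : ℕ} (φ : Torus d → ℝ) : Prop :=
  ContDiff ℝ ∞ (fun x : Space d => φ (toTorus x))

/-- The classical partial derivative `∂_i φ` of a function on the torus; it is used for smooth `φ`
only. -/
def partialDeriv {d : ℕ} (i : Fin d) (φ : Torus d → ℝ) (x : Torus d) : ℝ :=
  deriv (fun s : ℝ => φ (x + Pi.single i (s : UnitAddCircle))) 0

/-- `g` is the weak partial derivative `∂_i f` on the torus. -/
def HasWeakPartialDeriv {d : ℕ} (i : Fin d) (f g : Torus d → ℝ) : Prop :=
  Integrable f ∧ Integrable g ∧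
    ∀ φ : Torus d → ℝ, IsSmooth φ →
      ∫ x, f x * partialDeriv i φ x = -∫ x, g x * φ x

/-- `u ∈ W^{1,p}(𝕋^d, ℝ^d)`. -/
def MemSobolev {d : ℕ} (p : ℝ≥0∞) (u : Torus d → Space d) : Prop :=
  MemLp u p ∧
    ∀ i j : Fin d, ∃ g : Torus d → ℝ,
      MemLp g p ∧ HasWeakPartialDeriv j (fun x => u x i) g

/-- `∇ · u = 0` in the sense of distributions on the torus. -/
def IsDivergenceFree {d : ℕ} (u : Torus d → Space d) : Prop :=
  ∀ φ : Torus d → ℝ, IsSmooth φ → ∫ x, ∑ i, u x i * partialDeriv i φ x = 0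

/-- The curve `γ` in the torus has at time `t` the velocity `v ∈ ℝ^d`, relative to the time
interval `S` (one-sided at an end of `S`): some lift of `γ` to `ℝ^d` has the derivative `v`. -/
def HasVelocityWithinAt {d : ℕ} (γ : ℝ → Torus d) (v : Space d) (S : Set ℝ) (t : ℝ) : Prop :=
  ∃ Γ : ℝ → Space d, (∀ s ∈ S, toTorus (Γ s) = γ s) ∧ HasDerivWithinAt Γ v S t

/-- `γ`, restricted to `[0, T]`, is a trajectory of the autonomous vector field `u` that starts
at `x`. The values of `γ` outside `[0, T]` play no role. -/
structure IsTrajectory {d : ℕ} (u : Torus d → Space d) (T : ℝ) (x : Torus d)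
    (γ : ℝ → Torus d) : Prop where
  absolutelyContinuous : AbsolutelyContinuousOnInterval γ 0 T
  velocity : ∀ t ∈ Icc 0 T, HasVelocityWithinAt γ (u (γ t)) (Icc 0 T) t
  start : γ 0 = x

/-- The set of initial conditions from which the trajectories on `[0, T]` are not unique: at least
two different ones start there. -/
def nonuniquenessSet {d : ℕ} (u : Torus d → Space d) (T : ℝ) : Set (Torus d) :=
  {x | ∃ γ₁ γ₂ : ℝ → Torus d, IsTrajectory u T x γ₁ ∧ IsTrajectory u T x γ₂ ∧
    ∃ t ∈ Icc 0 T, γ₁ t ≠ γ₂ t}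

end SteadyFlow

end

/-! The coordinate `x 0` plays the role of time: the field is `lam * (1, v)`, where `v` depends on
`x 0` and has zero divergence in the other `d - 1 = n + 2` coordinates. At time `s` the `i`-th
generation of `v` acts only while `2 ^ i * s` lies in a fixed window, so the generations are
disjoint in time and accumulate only at integral times. There every point splits.

Generation `i` acts in all cubes of side `N ^ (-i)`. In each it translates `2 * N ^ (n + 2)` small
balls, one for every choice of `n + 2` digits and of a family `b ∈ {0, 1}`, from the centres `(digit
+ b / 2) / N` to `gap * digit + b / 2`, in units of the cube. Start at an integral time from a point
with base-`N` digits `D j`. Generation `j` replaces the contribution `D j / N ^ (j + 1)` by `η ^ (j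
+ 1) * D j + (b / 2) * (1 - 1 / N) / N ^ j`, the finest generations first. After one period the
digit part does not depend on `b`, while the offsets add up to `b / 2`. The two families thus give
two solutions from the same point that end half a period apart (`exists_two_solutions`).

That these curves solve the equation rests on two facts. While generation `i` moves, the coarser
digits change `N ^ i * y` by an integer only and the finer ones leave it within `gap / 4` of the
centre of one ball (`exists_path_eq`). Balls with different labels never meet
(`exists_gap_le_abs_centre_sub`). Hence the field on the curve is exactly the speed of that ball
(`generation_path`).

A point with non-integral time meets finitely many generations before the next integral time.
Picard-Lindelöf leads it there (`exists_solution_to_integer`), so uniqueness fails from every point.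

Up to constants, generation `i` has speed `(2 / N) ^ i`, gradient `(2 / (N * η)) ^ i` and support of
volume `(η * N) ^ ((n + 2) * i)`. `IsGeometric` turns such bounds into Hölder and Sobolev regularity
under two inequalities on ratios. With `η = N ^ (-β)` and `N` large they reduce to `β < 1 / α` and,
for `β > 1`, to `p < n + 2 = d - 1` (`exists_parameters`). The divergence vanishes because each ball
is moved by two derivatives of one stream function. -/

noncomputable section

namespace SteadyFlow

/-! ### Differential calculus on the torus -/

/-- `g` is the classical partial derivative `∂_j f` of `f` at every point of the torus. -/
def HasPartial {d : ℕ} (j : Fin d) (f g : Torus d → ℝ) : Prop :=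
  ∀ x, HasDerivAt (fun s : ℝ => f (x + Pi.single j (s : UnitAddCircle))) (g x) 0

section Calculus

variable {d : ℕ} {j : Fin d} {f g f' g' : Torus d → ℝ}

lemma single_coe_add (j : Fin d) (s t : ℝ) :
    (Pi.single j ((s + t : ℝ) : UnitAddCircle) : Torus d)
      = Pi.single j (s : UnitAddCircle) + Pi.single j (t : UnitAddCircle) := by
  rw [AddCircle.coe_add, Pi.single_add]

lemma HasPartial.hasDerivAt (h : HasPartial j f g) (x : Torus d) (s : ℝ) :
    HasDerivAt (fun s : ℝ => f (x + Pi.single j (s : UnitAddCircle)))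
      (g (x + Pi.single j (s : UnitAddCircle))) s := by
  have h0 := h (x + Pi.single j (s : UnitAddCircle))
  have h2 : HasDerivAt (fun r : ℝ => f (x + Pi.single j (s : UnitAddCircle)
      + Pi.single j ((r - s : ℝ) : UnitAddCircle)))
      (g (x + Pi.single j (s : UnitAddCircle))) s := by
    have := HasDerivAt.comp_sub_const (x := s) (a := s)
      (f := fun r : ℝ => f (x + Pi.single j (s : UnitAddCircle)
        + Pi.single j (r : UnitAddCircle))) (by simpa using h0)
    exact this
  refine h2.congr_of_eventuallyEq (Filter.Eventually.of_forall fun r => ?_)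
  simp only
  rw [add_assoc, ← single_coe_add]
  simp

lemma HasPartial.const_mul (c : ℝ) (hf : HasPartial j f f') :
    HasPartial j (fun x => c * f x) (fun x => c * f' x) :=
  fun x => (hf x).const_mul c

lemma HasPartial.mul (hf : HasPartial j f f') (hg : HasPartial j g g') :
    HasPartial j (fun x => f x * g x) (fun x => f' x * g x + f x * g' x) := by
  intro x
  simpa using (hf x).fun_mul (hg x)

lemma HasPartial.sum {ι : Type*} (s : Finset ι) {F F' : ι → Torus d → ℝ}
    (h : ∀ i ∈ s, HasPartial j (F i) (F' i)) :
    HasPartial j (fun x => ∑ i ∈ s, F i x) (fun x => ∑ i ∈ s, F' i x) :=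
  fun x => HasDerivAt.fun_sum fun i hi => h i hi x

lemma integrable_of_continuous (hf : Continuous f) : Integrable f :=
  hf.integrable_of_hasCompactSupport (HasCompactSupport.of_compactSpace f)

/-- The integral of a partial derivative over the torus vanishes, by translation invariance. -/
lemma HasPartial.integral_eq_zero (h : HasPartial j f g) (hf : Continuous f) (hg : Continuous g) :
    ∫ x, g x = 0 := by
  obtain ⟨C, hC⟩ := (isCompact_range hg).isBounded.exists_norm_le
  have key := hasDerivAt_integral_of_dominated_loc_of_deriv_le (μ := (volume : Measure (Torus d)))
    (F := fun (s : ℝ) x => f (x + Pi.single j (s : UnitAddCircle)))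
    (F' := fun (s : ℝ) x => g (x + Pi.single j (s : UnitAddCircle)))
    (bound := fun _ => C) (x₀ := (0 : ℝ)) (s := univ) Filter.univ_mem
    (Filter.Eventually.of_forall fun s =>
      (by fun_prop : Continuous fun x : Torus d => f (x + Pi.single j (s : UnitAddCircle))
        ).aestronglyMeasurable)
    (integrable_of_continuous (by fun_prop)) (by
      exact (by fun_prop : Continuous fun x : Torus d =>
        g (x + Pi.single j ((0 : ℝ) : UnitAddCircle))).aestronglyMeasurable)
    (Filter.Eventually.of_forall fun x s _ => hC _ ⟨_, rfl⟩)
    (integrable_const C)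
    (Filter.Eventually.of_forall fun x s _ => h.hasDerivAt x s)
  have h1 := key.2
  simp only [integral_add_right_eq_self (μ := (volume : Measure (Torus d))) f] at h1
  have h2 := h1.unique (hasDerivAt_const _ _)
  simpa using h2

lemma HasPartial.integral_mul (hf : HasPartial j f f') (hg : HasPartial j g g')
    (cf : Continuous f) (cf' : Continuous f') (cg : Continuous g) (cg' : Continuous g') :
    ∫ x, f x * g' x = -∫ x, f' x * g x := by
  have h := (hf.mul hg).integral_eq_zero (by fun_prop) (by fun_prop)
  rw [integral_add (integrable_of_continuous (by fun_prop))
    (integrable_of_continuous (by fun_prop))] at h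
  linarith

/-- A function on the torus with bounded partial derivatives is Lipschitz. -/
lemma abs_sub_le_of_hasPartial {F : Torus d → ℝ} {F' : Fin d → Torus d → ℝ} {L : ℝ}
    (hF : ∀ j, HasPartial j F (F' j)) (hL : ∀ j x, |F' j x| ≤ L) (x y : Torus d) :
    |F x - F y| ≤ d * L * dist x y := by
  have step : ∀ (j : Fin d) (z : Torus d) (a : UnitAddCircle),
      |F (z + Pi.single j a) - F z| ≤ L * ‖a‖ := by
    intro j z a
    obtain ⟨r, rfl⟩ := QuotientAddGroup.mk_surjective a
    -- The representative nearest to zero: the segment from `0` to `r'` has length exactly the norm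
    -- on the circle.
    set r' : ℝ := r - round r with hr'
    have e1 : ((r : ℝ) : UnitAddCircle) = ((r' : ℝ) : UnitAddCircle) := by
      rw [hr', AddCircle.coe_sub]
      have : (((round r : ℤ) : ℝ) : UnitAddCircle) = 0 := by
        rw [AddCircle.coe_eq_zero_iff]; exact ⟨round r, by simp⟩
      rw [this, sub_zero]
    have e2 : ‖((r : ℝ) : UnitAddCircle)‖ = |r'| := by
      rw [UnitAddCircle.norm_eq]
    change |F (z + Pi.single j ((r : ℝ) : UnitAddCircle)) - F z| ≤ L * ‖((r : ℝ) : UnitAddCircle)‖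
    rw [e2, e1]
    have := Convex.norm_image_sub_le_of_norm_hasDerivWithin_le (s := univ)
      (f := fun s : ℝ => F (z + Pi.single j (s : UnitAddCircle))) (C := L) (x := 0) (y := r')
      (fun s _ => ((hF j).hasDerivAt z s).hasDerivWithinAt) (fun s _ => hL j _) convex_univ
      (mem_univ _) (mem_univ _)
    simpa using this
  -- The coordinates of `y` are replaced by those of `x` one at a time, each at the cost `L * dist x
  -- y`.
  have main : ∀ S : Finset (Fin d), |F (S.piecewise x y) - F y| ≤ S.card * L * dist x y := by
    intro S
    induction S using Finset.induction_on with
    | empty => simp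
    | insert j S hj ih =>
      have e : (insert j S).piecewise x y = S.piecewise x y + Pi.single j (x j - y j) := by
        ext m
        by_cases hm : m = j
        · subst hm; simp [hj]
        · simp [Finset.piecewise, hm]
      have h1 := step j (S.piecewise x y) (x j - y j)
      rw [← e] at h1
      have h2 : ‖x j - y j‖ ≤ dist x y := by
        rw [← dist_eq_norm]; exact dist_le_pi_dist x y j
      have hL0 : 0 ≤ L := (abs_nonneg _).trans (hL j x)
      rw [Finset.card_insert_of_notMem hj]
      push_cast
      calc |F ((insert j S).piecewise x y) - F y|
          ≤ |F ((insert j S).piecewise x y) - F (S.piecewise x y)|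
            + |F (S.piecewise x y) - F y| := abs_sub_le _ _ _
        _ ≤ L * ‖x j - y j‖ + S.card * L * dist x y := add_le_add h1 ih
        _ ≤ L * dist x y + S.card * L * dist x y := by gcongr
        _ = _ := by ring
  simpa using main Finset.univ

end Calculus

/-! ### Smooth functions on the torus through their periodic lifts -/

section Smooth

variable {d : ℕ}

lemma isOpenQuotientMap_toTorus : IsOpenQuotientMap (toTorus : Space d → Torus d) := by
  have h : IsOpenQuotientMap
      (Pi.map (fun _ : Fin d => (fun r : ℝ => (r : UnitAddCircle)))) :=
    IsOpenQuotientMap.piMap fun _ => QuotientAddGroup.isOpenQuotientMap_mk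
  exact h.comp (EuclideanSpace.equiv (Fin d) ℝ).toHomeomorph.isOpenQuotientMap

lemma toTorus_add (x y : Space d) : toTorus (x + y) = toTorus x + toTorus y := by
  ext i; simp [toTorus]

lemma toTorus_single (j : Fin d) (s : ℝ) :
    toTorus (EuclideanSpace.single j s) = Pi.single j (s : UnitAddCircle) := by
  ext i
  by_cases h : i = j
  · subst h; simp [toTorus]
  · simp [toTorus, h]

lemma lipschitzWith_toTorus : LipschitzWith 1 (toTorus : Space d → Torus d) := by
  refine LipschitzWith.of_dist_le_mul fun x y => ?_
  rw [NNReal.coe_one, one_mul, dist_pi_le_iff dist_nonneg]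
  intro i
  have h1 : dist (toTorus x i) (toTorus y i) ≤ |x i - y i| := by
    rw [dist_eq_norm]
    simp only [toTorus, ← AddCircle.coe_sub]
    rw [UnitAddCircle.norm_eq]
    exact round_le _ 0 |>.trans (by simp)
  refine h1.trans ?_
  rw [dist_eq_norm]
  exact PiLp.norm_apply_le (x - y) i

variable {φ : Torus d → ℝ}

lemma IsSmooth.continuous (h : IsSmooth φ) : Continuous φ := by
  rw [isOpenQuotientMap_toTorus.isQuotientMap.continuous_iff]
  exact ContDiff.continuous h

lemma IsSmooth.hasDerivAt_single (h : IsSmooth φ) (j : Fin d) (x : Space d) :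
    HasDerivAt (fun s : ℝ => φ (toTorus x + Pi.single j (s : UnitAddCircle)))
      (fderiv ℝ (fun x : Space d => φ (toTorus x)) x (EuclideanSpace.single j 1)) 0 := by
  have hd : DifferentiableAt ℝ (fun x : Space d => φ (toTorus x)) x :=
    (ContDiff.differentiable h (by simp)).differentiableAt
  have h1 : HasDerivAt (fun s : ℝ => x + s • (EuclideanSpace.single j (1 : ℝ) : Space d))
      (EuclideanSpace.single j (1 : ℝ)) 0 := by
    simpa using ((hasDerivAt_id (0 : ℝ)).smul_const
      (EuclideanSpace.single j (1 : ℝ) : Space d)).const_add x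
  have h2 := HasFDerivAt.comp_hasDerivAt (0 : ℝ) (f := fun s : ℝ =>
    x + s • (EuclideanSpace.single j (1 : ℝ) : Space d)) (by simpa using hd.hasFDerivAt) h1
  refine h2.congr_of_eventuallyEq (Filter.Eventually.of_forall fun s => ?_)
  have : s • (EuclideanSpace.single j (1 : ℝ) : Space d) = EuclideanSpace.single j s := by
    ext i; by_cases hi : i = j
    · subst hi; simp
    · simp [hi]
  simp only [Function.comp, this, toTorus_add, toTorus_single]

lemma IsSmooth.hasPartial (h : IsSmooth φ) (j : Fin d) : HasPartial j φ (partialDeriv j φ) := by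
  intro x
  obtain ⟨x, rfl⟩ := isOpenQuotientMap_toTorus.surjective x
  exact (h.hasDerivAt_single j x).differentiableAt.hasDerivAt

lemma IsSmooth.continuous_partialDeriv (h : IsSmooth φ) (j : Fin d) :
    Continuous (partialDeriv j φ) := by
  rw [isOpenQuotientMap_toTorus.isQuotientMap.continuous_iff]
  have e : partialDeriv j φ ∘ toTorus = fun x =>
      fderiv ℝ (fun x : Space d => φ (toTorus x)) x (EuclideanSpace.single j 1) := by
    ext x
    exact (h.hasDerivAt_single j x).deriv
  rw [e]
  exact (ContDiff.continuous_fderiv h (by simp)).clm_apply continuous_const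

end Smooth

/-! ### Series of localised `C¹` functions -/

/-- `F` is a `C¹` function with partial derivatives `F' j`, bounded by `A`, with derivatives bounded
by `L`, and both vanish outside `S`. -/
structure IsLocalized {d : ℕ} (F : Torus d → ℝ) (F' : Fin d → Torus d → ℝ) (A L : ℝ)
    (S : Set (Torus d)) : Prop where
  continuous : Continuous F
  continuous_deriv : ∀ j, Continuous (F' j)
  hasPartial : ∀ j, HasPartial j F (F' j)
  bound : ∀ x, |F x| ≤ A
  bound_deriv : ∀ j x, |F' j x| ≤ L
  eq_zero : ∀ x ∉ S, F x = 0
  deriv_eq_zero : ∀ j, ∀ x ∉ S, F' j x = 0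

namespace IsLocalized

variable {d : ℕ} {F G : Torus d → ℝ} {F' G' : Fin d → Torus d → ℝ} {A L A₁ L₁ : ℝ}
  {S : Set (Torus d)}

lemma mono (h : IsLocalized F F' A L S) {T : Set (Torus d)} (hA : A ≤ A₁) (hL : L ≤ L₁)
    (hS : S ⊆ T) : IsLocalized F F' A₁ L₁ T :=
  ⟨h.continuous, h.continuous_deriv, h.hasPartial, fun x => (h.bound x).trans hA,
    fun j x => (h.bound_deriv j x).trans hL, fun x hx => h.eq_zero x fun h' => hx (hS h'),
    fun j x hx => h.deriv_eq_zero j x fun h' => hx (hS h')⟩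

lemma const_mul (h : IsLocalized F F' A L S) (c : ℝ) :
    IsLocalized (fun x => c * F x) (fun j x => c * F' j x) (|c| * A) (|c| * L) S :=
  ⟨h.continuous.const_mul c, fun j => (h.continuous_deriv j).const_mul c,
    fun j => (h.hasPartial j).const_mul c,
    fun x => by rw [abs_mul]; exact mul_le_mul_of_nonneg_left (h.bound x) (abs_nonneg c),
    fun j x => by
      rw [abs_mul]; exact mul_le_mul_of_nonneg_left (h.bound_deriv j x) (abs_nonneg c),
    fun x hx => by rw [h.eq_zero x hx, mul_zero],
    fun j x hx => by rw [h.deriv_eq_zero j x hx, mul_zero]⟩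

lemma sum {ι : Type*} (s : Finset ι) {F : ι → Torus d → ℝ} {F' : ι → Fin d → Torus d → ℝ}
    {A L : ι → ℝ} (h : ∀ i ∈ s, IsLocalized (F i) (F' i) (A i) (L i) S) :
    IsLocalized (fun x => ∑ i ∈ s, F i x) (fun j x => ∑ i ∈ s, F' i j x)
      (∑ i ∈ s, A i) (∑ i ∈ s, L i) S :=
  ⟨continuous_finsetSum _ fun i hi => (h i hi).continuous,
    fun j => continuous_finsetSum _ fun i hi => (h i hi).continuous_deriv j,
    fun j => HasPartial.sum s fun i hi => (h i hi).hasPartial j,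
    fun x => (Finset.abs_sum_le_sum_abs _ _).trans
      (Finset.sum_le_sum fun i hi => (h i hi).bound x),
    fun j x => (Finset.abs_sum_le_sum_abs _ _).trans
      (Finset.sum_le_sum fun i hi => (h i hi).bound_deriv j x),
    fun x hx => Finset.sum_eq_zero fun i hi => (h i hi).eq_zero x hx,
    fun j x hx => Finset.sum_eq_zero fun i hi => (h i hi).deriv_eq_zero j x hx⟩

lemma nonneg_bound (h : IsLocalized F F' A L S) : 0 ≤ A := (abs_nonneg _).trans (h.bound 0)

lemma abs_sub_le (h : IsLocalized F F' A L S) (x y : Torus d) :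
    |F x - F y| ≤ d * L * dist x y :=
  abs_sub_le_of_hasPartial h.hasPartial h.bound_deriv x y

/-- Interpolation between the uniform bound and the Lipschitz bound. -/
lemma abs_sub_le_rpow (h : IsLocalized F F' A L S) (hL : 0 ≤ L) {α : ℝ} (hα₀ : 0 ≤ α)
    (hα₁ : α ≤ 1) (x y : Torus d) :
    |F x - F y| ≤ (2 * A) ^ (1 - α) * (d * L) ^ α * dist x y ^ α := by
  have h1 : |F x - F y| ≤ 2 * A := by
    calc |F x - F y| ≤ |F x| + |F y| := abs_sub _ _
      _ ≤ 2 * A := by linarith [h.bound x, h.bound y]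
  have h2 := h.abs_sub_le x y
  have h0 := abs_nonneg (F x - F y)
  calc |F x - F y| = |F x - F y| ^ (1 - α) * |F x - F y| ^ α := by
        rw [← Real.rpow_add_of_nonneg h0 (by linarith) hα₀]; simp
    _ ≤ (2 * A) ^ (1 - α) * (d * L * dist x y) ^ α := by
        have hA := h.nonneg_bound
        gcongr
    _ = _ := by
        rw [Real.mul_rpow (by positivity) dist_nonneg, mul_assoc]

lemma hasWeakPartialDeriv (h : IsLocalized F F' A L S) (j : Fin d) :
    HasWeakPartialDeriv j F (F' j) :=
  ⟨integrable_of_continuous h.continuous, integrable_of_continuous (h.continuous_deriv j),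
    fun _ hφ => (h.hasPartial j).integral_mul (hφ.hasPartial j) h.continuous
      (h.continuous_deriv j) hφ.continuous (hφ.continuous_partialDeriv j)⟩

lemma lintegral_rpow_le (h : IsLocalized F F' A L S) (j : Fin d) {p : ℝ} (hp : 0 < p) :
    ∫⁻ x, ‖F' j x‖ₑ ^ p ≤ ENNReal.ofReal L ^ p * volume S := by
  calc ∫⁻ x, ‖F' j x‖ₑ ^ p
      -- `S` is not assumed measurable; its measurable hull has the same volume.
      ≤ ∫⁻ x, (toMeasurable volume S).indicator (fun _ => ENNReal.ofReal L ^ p) x := by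
        refine lintegral_mono fun x => ?_
        by_cases hx : x ∈ toMeasurable volume S
        · rw [indicator_of_mem hx]
          gcongr
          rw [Real.enorm_eq_ofReal_abs]
          exact ENNReal.ofReal_le_ofReal (h.bound_deriv j x)
        · rw [h.deriv_eq_zero j x fun h' => hx (subset_toMeasurable _ _ h')]
          simp [hp]
    _ = _ := by
        rw [lintegral_indicator_const (measurableSet_toMeasurable _ _), measure_toMeasurable]

end IsLocalized

/-- The hypotheses on a sequence of localised functions, with geometrically controlled bounds, under
which its sum is Hölder continuous and has a weak derivative in `L^p`. -/
structure IsGeometric {d : ℕ} (F : ℕ → Torus d → ℝ) (F' : ℕ → Fin d → Torus d → ℝ)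
    (S : ℕ → Set (Torus d)) (C a l r : ℝ) : Prop where
  nonneg : 0 ≤ C
  nonneg_amplitude : 0 ≤ a
  amplitude_lt : a < 1
  one_le_slope : 1 ≤ l
  nonneg_volume : 0 ≤ r
  localized : ∀ i, IsLocalized (F i) (F' i) (C * a ^ i) (C * l ^ i) (S i)
  disjoint : Pairwise (Function.onFun Disjoint S)
  volume_le : ∀ i, volume (S i) ≤ ENNReal.ofReal (C * r ^ i)

namespace IsGeometric

variable {d : ℕ} {F : ℕ → Torus d → ℝ} {F' : ℕ → Fin d → Torus d → ℝ}
    {S : ℕ → Set (Torus d)} {C a l r : ℝ}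

lemma summable_bound (h : IsGeometric F F' S C a l r) : Summable fun i => C * a ^ i :=
  (summable_geometric_of_lt_one h.nonneg_amplitude h.amplitude_lt).mul_left C

lemma summable (h : IsGeometric F F' S C a l r) (x : Torus d) : Summable fun i => F i x :=
  Summable.of_norm_bounded h.summable_bound fun i => (h.localized i).bound x

lemma continuous_tsum (h : IsGeometric F F' S C a l r) : Continuous fun x => ∑' i, F i x :=
  _root_.continuous_tsum (fun i => (h.localized i).continuous) h.summable_bound
    fun i x => (h.localized i).bound x

/-- The sets `S i` are disjoint, so at most one term is nonzero at each point. This replaces a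
uniform bound, which fails when the slopes grow, and lets the `p`-th power of the sum be estimated
by a single term. -/
lemma hasSum_deriv_or (h : IsGeometric F F' S C a l r) (j : Fin d) (x : Torus d) :
    (∃ k, HasSum (fun i => F' i j x) (F' k j x)) ∨ HasSum (fun i => F' i j x) 0 := by
  by_cases hx : ∃ k, x ∈ S k
  · obtain ⟨k, hk⟩ := hx
    refine Or.inl ⟨k, hasSum_single k fun i hi => ?_⟩
    exact (h.localized i).deriv_eq_zero j x fun hi' => Set.disjoint_left.1 (h.disjoint hi) hi' hk
  · push Not at hx
    refine Or.inr ?_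
    have : (fun i => F' i j x) = fun _ => 0 := by
      ext i; exact (h.localized i).deriv_eq_zero j x (hx i)
    rw [this]; exact hasSum_zero

lemma summable_deriv (h : IsGeometric F F' S C a l r) (j : Fin d) (x : Torus d) :
    Summable fun i => F' i j x := by
  rcases h.hasSum_deriv_or j x with ⟨k, hk⟩ | hk
  exacts [hk.summable, hk.summable]

lemma measurable_tsum_deriv (h : IsGeometric F F' S C a l r) (j : Fin d) :
    Measurable fun x => ∑' i, F' i j x := by
  refine measurable_of_tendsto_metrizable
    (f := fun n x => ∑ i ∈ Finset.range n, F' i j x) (fun n => ?_) ?_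
  · exact (continuous_finsetSum _ fun i _ => (h.localized i).continuous_deriv j).measurable
  · rw [tendsto_pi_nhds]
    exact fun x => (h.summable_deriv j x).hasSum.tendsto_sum_nat

/-- Slope to the power `p` against volume of the support: the terms are dominated by a geometric
series of ratio `l ^ p * r`. -/
lemma tsum_lintegral_rpow_lt_top (h : IsGeometric F F' S C a l r) (j : Fin d) {p : ℝ} (hp : 0 < p)
    (hlr : l ^ p * r < 1) : ∑' i, ∫⁻ x, ‖F' i j x‖ₑ ^ p < ⊤ := by
  have hl : 0 ≤ l := zero_le_one.trans h.one_le_slope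
  have hC := h.nonneg
  have hr := h.nonneg_volume
  have hq : 0 ≤ l ^ p * r := by positivity
  have e : ∀ i, ENNReal.ofReal (C * l ^ i) ^ p * ENNReal.ofReal (C * r ^ i)
      = ENNReal.ofReal (C ^ p * C * (l ^ p * r) ^ i) := by
    intro i
    rw [ENNReal.ofReal_rpow_of_nonneg (by positivity) hp.le, ← ENNReal.ofReal_mul (by positivity)]
    congr 1
    rw [Real.mul_rpow hC (by positivity), mul_pow, ← Real.rpow_natCast l i, ← Real.rpow_mul hl,
      ← Real.rpow_natCast (l ^ p) i, ← Real.rpow_mul hl, mul_comm (i : ℝ) p]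
    ring
  calc ∑' i, ∫⁻ x, ‖F' i j x‖ₑ ^ p
      ≤ ∑' i, ENNReal.ofReal (C ^ p * C * (l ^ p * r) ^ i) := by
        refine ENNReal.tsum_le_tsum fun i => ((h.localized i).lintegral_rpow_le j hp).trans ?_
        rw [← e]
        gcongr
        exact h.volume_le i
    _ < ⊤ := by
        have hs : Summable fun i => C ^ p * C * (l ^ p * r) ^ i :=
          (summable_geometric_of_lt_one hq hlr).mul_left _
        rw [← ENNReal.ofReal_tsum_of_nonneg (fun i => by positivity) hs]
        exact ENNReal.ofReal_lt_top

lemma memLp_tsum_deriv (h : IsGeometric F F' S C a l r) (j : Fin d) {p : ℝ} (hp : 0 < p)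
    (hlr : l ^ p * r < 1) : MemLp (fun x => ∑' i, F' i j x) (ENNReal.ofReal p) := by
  refine ⟨(h.measurable_tsum_deriv j).aestronglyMeasurable, ?_⟩
  rw [eLpNorm_lt_top_iff_lintegral_rpow_enorm_lt_top (by simpa using hp) ENNReal.ofReal_ne_top,
    ENNReal.toReal_ofReal hp.le]
  refine lt_of_le_of_lt ?_ (h.tsum_lintegral_rpow_lt_top j hp hlr)
  rw [← lintegral_tsum fun i => by
    exact ((((h.localized i).continuous_deriv j).measurable.enorm).pow_const p).aemeasurable]
  refine lintegral_mono fun x => ?_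
  rcases h.hasSum_deriv_or j x with ⟨k, hk⟩ | hk
  · simp only [hk.tsum_eq]
    exact ENNReal.le_tsum (f := fun i => ‖F' i j x‖ₑ ^ p) k
  · simp [hk.tsum_eq, hp]

lemma summable_integral_norm_deriv (h : IsGeometric F F' S C a l r) (j : Fin d) (hlr : l * r < 1) :
    Summable fun i => ∫ x, ‖F' i j x‖ := by
  have h1 := h.tsum_lintegral_rpow_lt_top j one_pos (by simpa using hlr)
  have h2 := ENNReal.summable_toReal h1.ne
  refine h2.congr fun i => ?_
  rw [integral_norm_eq_lintegral_enorm ((h.localized i).continuous_deriv j).aestronglyMeasurable]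
  simp

/-- Every summand is `C¹` and integrates by parts classically. Amplitudes and `L¹` norms of
derivatives are summable, so both sides pass through the series. -/
lemma hasWeakPartialDeriv_tsum (h : IsGeometric F F' S C a l r) (j : Fin d) {p : ℝ} (hp : 1 ≤ p)
    (hlr : l ^ p * r < 1) :
    HasWeakPartialDeriv j (fun x => ∑' i, F i x) (fun x => ∑' i, F' i j x) := by
  refine ⟨integrable_of_continuous h.continuous_tsum,
    (h.memLp_tsum_deriv j (by linarith) hlr).integrable (by simpa using hp), fun φ hφ => ?_⟩
  -- Since `1 ≤ l`, the condition for `p` contains the one for the exponent `1`, which gives the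
  -- `L¹` summability.
  have hlr1 : l * r < 1 := by
    refine lt_of_le_of_lt ?_ hlr
    gcongr
    · exact h.nonneg_volume
    · exact Real.self_le_rpow_of_one_le h.one_le_slope hp
  obtain ⟨K, hK⟩ := (isCompact_range hφ.continuous).isBounded.exists_norm_le
  obtain ⟨K', hK'⟩ := (isCompact_range (hφ.continuous_partialDeriv j)).isBounded.exists_norm_le
  have s1 : HasSum (fun i => ∫ x, F i x * partialDeriv j φ x)
      (∫ x, ∑' i, F i x * partialDeriv j φ x) := by
    refine hasSum_integral_of_summable_integral_norm (fun i => integrable_of_continuous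
      ((h.localized i).continuous.mul (hφ.continuous_partialDeriv j))) ?_
    refine Summable.of_nonneg_of_le (fun i => integral_nonneg fun x => norm_nonneg _)
      (fun i => ?_) ((h.summable_bound.mul_right K').mul_right
        ((volume : Measure (Torus d)).real univ))
    refine (Real.le_norm_self _).trans ((norm_integral_le_of_norm_le_const
      (C := C * a ^ i * K') (Filter.Eventually.of_forall fun x => ?_)))
    rw [norm_norm, norm_mul]
    exact mul_le_mul ((h.localized i).bound x) (hK' _ ⟨x, rfl⟩) (norm_nonneg _)
      (h.localized i).nonneg_bound
  have s2 : HasSum (fun i => ∫ x, F' i j x * φ x) (∫ x, ∑' i, F' i j x * φ x) := by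
    refine hasSum_integral_of_summable_integral_norm (fun i => integrable_of_continuous
      (((h.localized i).continuous_deriv j).mul hφ.continuous)) ?_
    refine Summable.of_nonneg_of_le (fun i => integral_nonneg fun x => norm_nonneg _)
      (fun i => ?_) ((h.summable_integral_norm_deriv j hlr1).mul_right K)
    rw [← integral_mul_const]
    refine integral_mono (integrable_of_continuous ?_) (integrable_of_continuous ?_) fun x => ?_
    · exact (((h.localized i).continuous_deriv j).mul hφ.continuous).norm
    · exact ((h.localized i).continuous_deriv j).norm.mul_const K
    · rw [norm_mul]
      exact mul_le_mul_of_nonneg_left (hK _ ⟨x, rfl⟩) (norm_nonneg _)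
  simp only [tsum_mul_right] at s1 s2
  rw [← s1.tsum_eq, ← s2.tsum_eq, ← tsum_neg]
  exact tsum_congr fun i => ((h.localized i).hasWeakPartialDeriv j).2.2 φ hφ

/-- Interpolation between amplitude and slope gives the `i`-th term a Hölder constant proportional
to `(a ^ (1 - α) * l ^ α) ^ i`, which is summable. -/
lemma exists_abs_sub_le_rpow (h : IsGeometric F F' S C a l r) {α : ℝ} (hα₀ : 0 ≤ α) (hα₁ : α ≤ 1)
    (hal : a ^ (1 - α) * l ^ α < 1) :
    ∃ K : ℝ, 0 ≤ K ∧ ∀ x y, |∑' i, F i x - ∑' i, F i y| ≤ K * dist x y ^ α := by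
  have hl : 0 ≤ l := zero_le_one.trans h.one_le_slope
  have hC := h.nonneg
  have ha := h.nonneg_amplitude
  set q := a ^ (1 - α) * l ^ α with hq
  have hq0 : 0 ≤ q := by positivity
  set K₀ : ℝ := (2 * C) ^ (1 - α) * (d * C) ^ α with hK₀
  have hs : Summable fun i => K₀ * q ^ i := (summable_geometric_of_lt_one hq0 hal).mul_left _
  refine ⟨∑' i, K₀ * q ^ i, tsum_nonneg fun i => by positivity, fun x y => ?_⟩
  have hi : ∀ i, ‖F i x - F i y‖ ≤ K₀ * q ^ i * dist x y ^ α := by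
    intro i
    refine ((h.localized i).abs_sub_le_rpow (by positivity) hα₀ hα₁ x y).trans (le_of_eq ?_)
    congr 1
    rw [← mul_assoc, ← mul_assoc, Real.mul_rpow (x := 2 * C) (by positivity) (by positivity),
      Real.mul_rpow (x := d * C) (by positivity) (by positivity), hq, mul_pow,
      ← Real.rpow_natCast a i, ← Real.rpow_natCast l i, ← Real.rpow_natCast (a ^ (1 - α)) i,
      ← Real.rpow_natCast (l ^ α) i, ← Real.rpow_mul ha, ← Real.rpow_mul hl, ← Real.rpow_mul ha,
      ← Real.rpow_mul hl, mul_comm (i : ℝ), mul_comm (i : ℝ)]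
    ring
  rw [← (h.summable x).tsum_sub (h.summable y), ← tsum_mul_right]
  exact tsum_of_norm_bounded (hs.mul_right _).hasSum hi

end IsGeometric

/-! ### Periodic functions of one variable -/

/-- `g'` is the derivative of the function `g` on the circle. -/
def HasCircleDeriv (g g' : UnitAddCircle → ℝ) : Prop :=
  ∀ x : ℝ, HasDerivAt (fun s : ℝ => g (s : UnitAddCircle)) (g' (x : UnitAddCircle)) x

lemma HasCircleDeriv.continuous {g g' : UnitAddCircle → ℝ} (h : HasCircleDeriv g g') :
    Continuous g := by
  rw [QuotientAddGroup.isOpenQuotientMap_mk.isQuotientMap.continuous_iff]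
  exact continuous_iff_continuousAt.2 fun x => (h x).continuousAt

lemma HasCircleDeriv.comp {g g' : UnitAddCircle → ℝ} (h : HasCircleDeriv g g') (a : UnitAddCircle)
    {φ : ℝ → ℝ} {φ' s : ℝ} (hφ : HasDerivAt φ φ' s) :
    HasDerivAt (fun s => g (a + (φ s : UnitAddCircle))) (g' (a + (φ s : UnitAddCircle)) * φ') s := by
  obtain ⟨r, rfl⟩ := QuotientAddGroup.mk_surjective a
  have h1 : HasDerivAt (fun s => r + φ s) φ' s := hφ.const_add r
  have h2 := HasDerivAt.comp s (h (r + φ s)) h1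
  simpa only [Function.comp_def, AddCircle.coe_add] using h2

/-- The periodic extension of the restriction of a function to `[0, 1)`. -/
def periodize (f : ℝ → ℝ) : UnitAddCircle → ℝ :=
  Function.Periodic.lift (f := fun t : ℝ => f (Int.fract t)) (c := (1 : ℝ)) fun t => by simp

lemma periodize_coe (f : ℝ → ℝ) (x : ℝ) : periodize f (x : UnitAddCircle) = f (Int.fract x) := rfl

/-- Off the integers the floor is locally constant. At an integer, the vanishing of `f` near both
ends of `[0, 1]` makes the periodic function locally zero, and it forces `f' 0 = 0`. -/
lemma hasCircleDeriv_periodize {f f' : ℝ → ℝ} (hf : ∀ x, HasDerivAt f (f' x) x) {ε : ℝ}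
    (hε : 0 < ε) (h0 : ∀ t, t ≤ ε → f t = 0) (h1 : ∀ t, 1 - ε ≤ t → f t = 0) :
    HasCircleDeriv (periodize f) (periodize f') := by
  intro x
  simp only [periodize_coe]
  by_cases hx : Int.fract x = 0
  · have hd : f' (Int.fract x) = 0 := by
      rw [hx]
      have h2 : HasDerivAt f 0 0 := (hasDerivAt_const (0 : ℝ) (0 : ℝ)).congr_of_eventuallyEq (by
        filter_upwards [gt_mem_nhds hε] with t ht using h0 t ht.le)
      exact (hf 0).unique h2
    rw [hd]
    refine (hasDerivAt_const x (0 : ℝ)).congr_of_eventuallyEq ?_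
    have hx' : x = ⌊x⌋ := by
      have := Int.floor_add_fract x; rw [hx] at this; linarith
    filter_upwards [Ioo_mem_nhds (sub_lt_self x (lt_min hε one_pos) : x - min ε 1 < x)
      (by linarith : x < x + ε)] with t ht
    rcases lt_or_ge t x with htx | htx
    · have hf1 : ⌊t⌋ = ⌊x⌋ - 1 := by
        rw [Int.floor_eq_iff]; push_cast
        constructor <;> linarith [ht.1, min_le_right ε (1 : ℝ)]
      refine h1 _ ?_
      have : Int.fract t = t - (⌊x⌋ - 1) := by rw [← Int.self_sub_floor, hf1]; push_cast; ring
      rw [this]; linarith [ht.1, min_le_left ε (1 : ℝ)]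
    · refine h0 _ ?_
      have h3 : (⌊x⌋ : ℤ) ≤ ⌊t⌋ := Int.floor_le_floor htx
      have h4 : (⌊x⌋ : ℝ) ≤ ⌊t⌋ := by exact_mod_cast h3
      rw [← Int.self_sub_floor]
      linarith [ht.2]
  · have hpos : 0 < Int.fract x := lt_of_le_of_ne (Int.fract_nonneg x) (Ne.symm hx)
    have h2 : HasDerivAt (fun t => f (t - ⌊x⌋)) (f' (Int.fract x)) x := by
      have := HasDerivAt.comp_sub_const (x := x) (a := (⌊x⌋ : ℝ)) (hf (x - ⌊x⌋))
      rwa [Int.self_sub_floor] at this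
    refine h2.congr_of_eventuallyEq ?_
    have e := Int.floor_add_fract x
    filter_upwards [Ioo_mem_nhds (by linarith : (⌊x⌋ : ℝ) < x) (Int.lt_floor_add_one x)] with t ht
    have : ⌊t⌋ = ⌊x⌋ := by
      rw [Int.floor_eq_iff]; exact ⟨ht.1.le, ht.2⟩
    rw [← Int.self_sub_floor, this]

/-- A smooth function supported in the open interval `(-2, 2)`. -/
structure IsProfile (f : ℝ → ℝ) : Prop where
  contDiff : ContDiff ℝ ∞ f
  tsupport_subset : tsupport f ⊆ Metric.ball 0 2

namespace IsProfile

variable {f : ℝ → ℝ}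

lemma eq_zero (h : IsProfile f) {z : ℝ} (hz : 2 ≤ |z|) : f z = 0 := by
  by_contra hne
  have := h.tsupport_subset (subset_tsupport f hne)
  rw [Metric.mem_ball, dist_zero_right, Real.norm_eq_abs] at this
  linarith

lemma deriv (h : IsProfile f) : IsProfile (deriv f) :=
  ⟨(contDiff_infty_iff_deriv.1 h.contDiff).2, (closure_minimal support_deriv_subset
    (isClosed_tsupport f)).trans h.tsupport_subset⟩

lemma hasDerivAt (h : IsProfile f) (x : ℝ) : HasDerivAt f (_root_.deriv f x) x :=
  (h.contDiff.differentiable (by simp)).differentiableAt.hasDerivAt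

lemma exists_bound (h : IsProfile f) : ∃ K, ∀ z, |f z| ≤ K := by
  have hc : HasCompactSupport f := HasCompactSupport.of_support_subset_isCompact
    (isCompact_closedBall (0 : ℝ) 2) ((subset_tsupport f).trans
      (h.tsupport_subset.trans Metric.ball_subset_closedBall))
  exact hc.exists_bound_of_continuous h.contDiff.continuous

end IsProfile

/-- The periodic function that is `z ↦ f (z / ρ)` near the integers. -/
def latticeBump (f : ℝ → ℝ) (ρ : ℝ) (a : UnitAddCircle) : ℝ :=
  periodize (fun t => f ((t - 1 / 2) / ρ)) (a + ((1 / 2 : ℝ) : UnitAddCircle))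

/-- The shift by half a period in the definition keeps the bump away from the seam of `periodize`.
-/
lemma latticeBump_coe (f : ℝ → ℝ) (ρ z : ℝ) :
    latticeBump f ρ (z : UnitAddCircle) = f ((z - round z) / ρ) := by
  rw [latticeBump, ← AddCircle.coe_add, periodize_coe, round_eq, ← Int.self_sub_floor]
  congr 2
  ring

lemma latticeBump_eq_zero {f : ℝ → ℝ} (hf : IsProfile f) {ρ : ℝ} (hρ : 0 < ρ) {a : UnitAddCircle}
    (ha : 2 * ρ ≤ ‖a‖) : latticeBump f ρ a = 0 := by
  obtain ⟨z, rfl⟩ := QuotientAddGroup.mk_surjective a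
  change 2 * ρ ≤ ‖((z : ℝ) : UnitAddCircle)‖ at ha
  rw [latticeBump_coe]
  refine hf.eq_zero ?_
  rw [UnitAddCircle.norm_eq] at ha
  rw [abs_div, abs_of_pos hρ, le_div_iff₀ hρ]
  exact ha

lemma abs_latticeBump_le {f : ℝ → ℝ} {K : ℝ} (hK : ∀ z, |f z| ≤ K) (ρ : ℝ) (a : UnitAddCircle) :
    |latticeBump f ρ a| ≤ K := by
  obtain ⟨z, rfl⟩ := QuotientAddGroup.mk_surjective a
  exact (congrArg abs (latticeBump_coe f ρ z)).trans_le (hK _)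

lemma hasCircleDeriv_latticeBump {f : ℝ → ℝ} (hf : IsProfile f) {ρ : ℝ} (hρ : 0 < ρ)
    (hρ' : ρ ≤ 1 / 8) :
    HasCircleDeriv (latticeBump f ρ) (fun a => ρ⁻¹ * latticeBump (deriv f) ρ a) := by
  have h1 : ∀ x, HasDerivAt (fun t => f ((t - 1 / 2) / ρ))
      (ρ⁻¹ * deriv f ((x - 1 / 2) / ρ)) x := by
    intro x
    have h2 : HasDerivAt (fun t : ℝ => (t - 1 / 2) / ρ) (1 / ρ) x :=
      ((hasDerivAt_id x).sub_const _).div_const ρ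
    have h3 := HasDerivAt.comp x (hf.hasDerivAt ((x - 1 / 2) / ρ)) h2
    rw [mul_comm, ← one_div]
    exact h3
  have h4 := hasCircleDeriv_periodize (ε := 1 / 4) h1 (by norm_num)
    (fun t ht => hf.eq_zero (by
      rw [abs_div, abs_of_pos hρ, le_div_iff₀ hρ, abs_of_neg (by linarith)]; linarith))
    (fun t ht => hf.eq_zero (by
      rw [abs_div, abs_of_pos hρ, le_div_iff₀ hρ, abs_of_pos (by linarith)]; linarith))
  intro x
  have h5 := HasDerivAt.comp_add_const x (1 / 2 : ℝ) (h4 (x + 1 / 2))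
  simp only [AddCircle.coe_add] at h5
  exact h5

/-! ### Products of periodic bumps with moving centres -/

section Block

variable {n : ℕ}

/-- The product of an amplitude, which depends on the coordinate `x 0`, and of bumps in the other
coordinates, around the points `y` such that `M • y = c (x 0)`. -/
def block (g : UnitAddCircle → ℝ) (c : Fin n → UnitAddCircle → ℝ) (f : Fin n → ℝ → ℝ) (ρ : ℝ)
    (M : ℕ) (x : Torus (n + 1)) : ℝ :=
  g (x 0) * ∏ m, latticeBump (f m) ρ (M • x m.succ - ((c m (x 0) : ℝ) : UnitAddCircle))

/-- The partial derivatives of a block. -/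
def blockDeriv (g g' : UnitAddCircle → ℝ) (c c' : Fin n → UnitAddCircle → ℝ)
    (f : Fin n → ℝ → ℝ) (ρ : ℝ) (M : ℕ) : Fin (n + 1) → Torus (n + 1) → ℝ :=
  Fin.cases
    (fun x => block g' c f ρ M x
      - ∑ m, c' m (x 0) / ρ * block g c (Function.update f m (deriv (f m))) ρ M x)
    (fun m x => M / ρ * block g c (Function.update f m (deriv (f m))) ρ M x)

/-- The points close to the centres of a block. -/
def blockSupport (I : Set UnitAddCircle) (c : Fin n → UnitAddCircle → ℝ) (ρ : ℝ) (M : ℕ) :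
    Set (Torus (n + 1)) :=
  {x | x 0 ∈ I ∧ ∀ m : Fin n, ‖M • x m.succ - ((c m (x 0) : ℝ) : UnitAddCircle)‖ ≤ 2 * ρ}

variable {g g' : UnitAddCircle → ℝ} {c c' : Fin n → UnitAddCircle → ℝ}
  {f : Fin n → ℝ → ℝ} {ρ : ℝ} {M : ℕ}

lemma block_update (m : Fin n) (h : ℝ → ℝ) (x : Torus (n + 1)) :
    block g c (Function.update f m h) ρ M x = g (x 0) *
      ((∏ m' ∈ Finset.univ.erase m,
        latticeBump (f m') ρ (M • x m'.succ - ((c m' (x 0) : ℝ) : UnitAddCircle))) *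
        latticeBump h ρ (M • x m.succ - ((c m (x 0) : ℝ) : UnitAddCircle))) := by
  rw [block, ← Finset.prod_erase_mul _ _ (Finset.mem_univ m)]
  congr 2
  · refine Finset.prod_congr rfl fun m' hm' => ?_
    rw [Function.update_of_ne (Finset.ne_of_mem_erase hm')]
  · simp

lemma continuous_block (hg : Continuous g) (hc : ∀ m, Continuous (c m)) (hf : ∀ m, IsProfile (f m))
    (hρ : 0 < ρ) (hρ' : ρ ≤ 1 / 8) : Continuous (block g c f ρ M) := by
  refine (hg.comp (continuous_apply 0)).mul (continuous_finsetProd _ fun m _ => ?_)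
  refine (hasCircleDeriv_latticeBump (hf m) hρ hρ').continuous.comp ?_
  refine ((continuous_nsmul M).comp (continuous_apply m.succ)).sub ?_
  exact (AddCircle.continuous_mk' (1 : ℝ)).comp
    ((hc m).comp (continuous_apply (A := fun _ : Fin (n + 1) => UnitAddCircle) 0))

lemma isProfile_update (hf : ∀ m, IsProfile (f m)) (m : Fin n) :
    ∀ m', IsProfile (Function.update f m (deriv (f m)) m') := by
  intro m'
  by_cases h : m' = m
  · subst h; simpa using (hf m').deriv
  · simpa [h] using hf m'

lemma block_hasPartial_succ (hf : ∀ m, IsProfile (f m)) (hρ : 0 < ρ) (hρ' : ρ ≤ 1 / 8)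
    (m : Fin n) :
    HasPartial m.succ (block g c f ρ M)
      (fun x => M / ρ * block g c (Function.update f m (deriv (f m))) ρ M x) := by
  intro x
  have hfac : ∀ m' ∈ (Finset.univ : Finset (Fin n)), HasDerivAt (fun s : ℝ => latticeBump (f m') ρ
      (M • (x + Pi.single m.succ (s : UnitAddCircle) : Torus (n + 1)) m'.succ
        - ((c m' (x 0) : ℝ) : UnitAddCircle)))
      (if m' = m then ρ⁻¹ * latticeBump (deriv (f m)) ρ
        (M • x m.succ - ((c m (x 0) : ℝ) : UnitAddCircle)) * M else 0) 0 := by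
    intro m' _
    by_cases h : m' = m
    · subst h
      have h1 := (hasCircleDeriv_latticeBump (hf m') hρ hρ').comp
        (M • x m'.succ - ((c m' (x 0) : ℝ) : UnitAddCircle)) (s := 0)
        (φ := fun s => (M : ℝ) * s) (by simpa using (hasDerivAt_id (0 : ℝ)).const_mul (M : ℝ))
      simp only [if_true]
      simp only [mul_zero, AddCircle.coe_zero, add_zero] at h1
      refine h1.congr_of_eventuallyEq (Filter.Eventually.of_forall fun s => ?_)
      simp only [Pi.add_apply, Pi.single_eq_same, smul_add]
      congr 1
      rw [← AddCircle.coe_nsmul, nsmul_eq_mul]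
      abel
    · have : ∀ s : ℝ, (x + Pi.single m.succ (s : UnitAddCircle) : Torus (n + 1)) m'.succ
          = x m'.succ := by
        intro s
        simp [h]
      simp only [this, h, if_false]
      exact hasDerivAt_const _ _
  have hp := HasDerivAt.fun_finsetProd hfac
  have h2 := hp.const_mul (g (x 0))
  have e0 : ∀ s : ℝ, (x + Pi.single m.succ (s : UnitAddCircle) : Torus (n + 1)) 0 = x 0 := by
    intro s
    simp [(Fin.succ_ne_zero m).symm]
  unfold block
  simp only [e0]
  refine h2.congr_deriv ?_
  have e1 := block_update (g := g) (c := c) (f := f) (ρ := ρ) (M := M) m (deriv (f m)) x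
  unfold block at e1
  rw [e1]
  simp only [smul_eq_mul, mul_ite, mul_zero, Finset.sum_ite_eq', Finset.mem_univ, if_true]
  simp only [AddCircle.coe_zero, Pi.single_zero, add_zero]
  field_simp

/-- Besides the derivative of the amplitude there is transport by the moving centres: the argument
of each bump contains `-c m (x 0)`, whence the minus sign and the factor `c' m / ρ`. -/
lemma block_hasPartial_zero (hg : HasCircleDeriv g g') (hc : ∀ m, HasCircleDeriv (c m) (c' m))
    (hf : ∀ m, IsProfile (f m)) (hρ : 0 < ρ) (hρ' : ρ ≤ 1 / 8) :
    HasPartial 0 (block g c f ρ M)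
      (fun x => block g' c f ρ M x
        - ∑ m, c' m (x 0) / ρ * block g c (Function.update f m (deriv (f m))) ρ M x) := by
  intro x
  have e0 : ∀ s : ℝ, (x + Pi.single 0 (s : UnitAddCircle) : Torus (n + 1)) 0 = x 0 + (s : ℝ) := by
    intro s; simp
  have es : ∀ (s : ℝ) (m : Fin n),
      (x + Pi.single 0 (s : UnitAddCircle) : Torus (n + 1)) m.succ = x m.succ := by
    intro s m; simp
  have hline : ∀ {k k' : UnitAddCircle → ℝ}, HasCircleDeriv k k' →
      HasDerivAt (fun s : ℝ => k (x 0 + (s : UnitAddCircle))) (k' (x 0)) 0 := by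
    intro k k' hk
    simpa using hk.comp (x 0) (hasDerivAt_id (0 : ℝ))
  have hfac : ∀ m ∈ (Finset.univ : Finset (Fin n)), HasDerivAt (fun s : ℝ => latticeBump (f m) ρ
      (M • x m.succ - ((c m (x 0 + (s : UnitAddCircle)) : ℝ) : UnitAddCircle)))
      (ρ⁻¹ * latticeBump (deriv (f m)) ρ
        (M • x m.succ - ((c m (x 0) : ℝ) : UnitAddCircle)) * (-(c' m (x 0)))) 0 := by
    intro m _
    have h1 := (hasCircleDeriv_latticeBump (hf m) hρ hρ').comp (M • x m.succ) (hline (hc m)).neg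
    simpa [sub_eq_add_neg] using h1
  have hp := (hline hg).fun_mul (HasDerivAt.fun_finsetProd hfac)
  unfold block
  simp only [e0, es]
  refine hp.congr_deriv ?_
  simp only [AddCircle.coe_zero, add_zero, smul_eq_mul]
  rw [sub_eq_add_neg, Finset.mul_sum, ← Finset.sum_neg_distrib]
  congr 1
  refine Finset.sum_congr rfl fun m _ => ?_
  have e1 := block_update (g := g) (c := c) (f := f) (ρ := ρ) (M := M) m (deriv (f m)) x
  unfold block at e1
  rw [e1]
  field_simp

lemma abs_block_le {A K : ℝ} (hg : ∀ a, |g a| ≤ A) (hK : ∀ m z, |f m z| ≤ K) (x : Torus (n + 1)) :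
    |block g c f ρ M x| ≤ A * K ^ n := by
  rw [block, abs_mul, Finset.abs_prod]
  refine mul_le_mul (hg _) ?_ (Finset.prod_nonneg fun _ _ => abs_nonneg _)
    ((abs_nonneg _).trans (hg 0))
  calc ∏ m, |latticeBump (f m) ρ (M • x m.succ - ((c m (x 0) : ℝ) : UnitAddCircle))|
      ≤ ∏ _m : Fin n, K := Finset.prod_le_prod (fun _ _ => abs_nonneg _)
        fun m _ => abs_latticeBump_le (hK m) ρ _
    _ = K ^ n := by simp

lemma block_eq_zero (hf : ∀ m, IsProfile (f m)) (hρ : 0 < ρ) {I : Set UnitAddCircle}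
    (hI : ∀ a ∉ I, g a = 0) {x : Torus (n + 1)} (hx : x ∉ blockSupport I c ρ M) :
    block g c f ρ M x = 0 := by
  by_cases h0 : x 0 ∈ I
  · have : ∃ m : Fin n, 2 * ρ < ‖M • x m.succ - ((c m (x 0) : ℝ) : UnitAddCircle)‖ := by
      by_contra hcon
      push Not at hcon
      exact hx ⟨h0, hcon⟩
    obtain ⟨m, hm⟩ := this
    rw [block, Finset.prod_eq_zero (Finset.mem_univ m) (latticeBump_eq_zero (hf m) hρ hm.le),
      mul_zero]
  · rw [block, hI _ h0, zero_mul]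

lemma isLocalized_block (hg : HasCircleDeriv g g') (hg' : Continuous g')
    (hc : ∀ m, HasCircleDeriv (c m) (c' m)) (hc' : ∀ m, Continuous (c' m))
    (hf : ∀ m, IsProfile (f m)) (hρ : 0 < ρ) (hρ' : ρ ≤ 1 / 8) {I : Set UnitAddCircle}
    (hI : ∀ a ∉ I, g a = 0) (hI' : ∀ a ∉ I, g' a = 0) {A A' Q K : ℝ}
    (hA : ∀ a, |g a| ≤ A) (hA' : ∀ a, |g' a| ≤ A') (hQ : ∀ m a, |c' m a| ≤ Q)
    (hK : ∀ m z, |f m z| ≤ K) (hK' : ∀ m z, |deriv (f m) z| ≤ K) :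
    IsLocalized (block g c f ρ M) (blockDeriv g g' c c' f ρ M) (A * K ^ n)
      (A' * K ^ n + (n * |Q| + M) / ρ * (A * K ^ n)) (blockSupport I c ρ M) := by
  have hA0 : 0 ≤ A := (abs_nonneg _).trans (hA 0)
  have hA'0 : 0 ≤ A' := (abs_nonneg _).trans (hA' 0)
  have hKn : 0 ≤ K ^ n := by
    -- For `n = 0` there are no factors, and the hypotheses do not even fix the sign of `K`; the
    -- same holds for `Q`, which therefore enters through `|Q|`.
    rcases Nat.eq_zero_or_pos n with h | h
    · subst h; simp
    · exact pow_nonneg ((abs_nonneg _).trans (hK ⟨0, h⟩ 0)) n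
  have hKu : ∀ m m' z, |Function.update f m (deriv (f m)) m' z| ≤ K := by
    intro m m' z
    by_cases h : m' = m
    · subst h; simpa using hK' m' z
    · simpa [h] using hK m' z
  have hcc := fun m => (hc m).continuous
  have hbu : ∀ m x, |block g c (Function.update f m (deriv (f m))) ρ M x| ≤ A * K ^ n :=
    fun m x => abs_block_le hA (hKu m) x
  refine ⟨continuous_block hg.continuous hcc hf hρ hρ', fun j => ?_, fun j => ?_,
    abs_block_le hA hK, fun j x => ?_, fun x hx => block_eq_zero hf hρ hI hx, fun j x hx => ?_⟩
  · refine Fin.cases ?_ (fun m => ?_) j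
    · refine (continuous_block hg' hcc hf hρ hρ').sub (continuous_finsetSum _ fun m _ => ?_)
      exact (((hc' m).comp (continuous_apply 0)).div_const ρ).mul
        (continuous_block hg.continuous hcc (isProfile_update hf m) hρ hρ')
    · exact (continuous_block hg.continuous hcc (isProfile_update hf m) hρ hρ').const_mul _
  · refine Fin.cases ?_ (fun m => ?_) j
    · exact block_hasPartial_zero hg hc hf hρ hρ'
    · exact block_hasPartial_succ hf hρ hρ' m
  · have hM : (0 : ℝ) ≤ M := Nat.cast_nonneg M
    refine Fin.cases ?_ (fun m => ?_) j
    · change |block g' c f ρ M x - ∑ m, c' m (x 0) / ρ *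
        block g c (Function.update f m (deriv (f m))) ρ M x| ≤ _
      have hs : |∑ m, c' m (x 0) / ρ * block g c (Function.update f m (deriv (f m))) ρ M x|
          ≤ n * |Q| / ρ * (A * K ^ n) := by
        refine (Finset.abs_sum_le_sum_abs _ _).trans ?_
        calc ∑ m, |c' m (x 0) / ρ * block g c (Function.update f m (deriv (f m))) ρ M x|
            ≤ ∑ _m : Fin n, |Q| / ρ * (A * K ^ n) := by
              refine Finset.sum_le_sum fun m _ => ?_
              rw [abs_mul, abs_div, abs_of_pos hρ]
              have h1 : |c' m (x 0)| ≤ |Q| := (hQ m _).trans (le_abs_self Q)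
              exact mul_le_mul (div_le_div_of_nonneg_right h1 hρ.le) (hbu m x) (abs_nonneg _)
                (by positivity)
          _ = _ := by simp; ring
      calc _ ≤ |block g' c f ρ M x| + |∑ m, c' m (x 0) / ρ *
            block g c (Function.update f m (deriv (f m))) ρ M x| := abs_sub _ _
        _ ≤ A' * K ^ n + n * |Q| / ρ * (A * K ^ n) := add_le_add (abs_block_le hA' hK x) hs
        _ ≤ _ := by
          gcongr
          linarith
    · change |M / ρ * block g c (Function.update f m (deriv (f m))) ρ M x| ≤ _
      rw [abs_mul, abs_div, abs_of_pos hρ, abs_of_nonneg hM]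
      calc _ ≤ M / ρ * (A * K ^ n) := by gcongr; exact hbu m x
        _ ≤ (n * |Q| + M) / ρ * (A * K ^ n) := by
          gcongr
          linarith [mul_nonneg (Nat.cast_nonneg n : (0 : ℝ) ≤ n) (abs_nonneg Q)]
        _ ≤ _ := by
          have : 0 ≤ A' * K ^ n := by positivity
          linarith
  · have hz : ∀ m, block g c (Function.update f m (deriv (f m))) ρ M x = 0 :=
      fun m => block_eq_zero (isProfile_update hf m) hρ hI hx
    refine Fin.cases ?_ (fun m => ?_) j
    · change block g' c f ρ M x - ∑ m, c' m (x 0) / ρ *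
        block g c (Function.update f m (deriv (f m))) ρ M x = 0
      simp [hz, block_eq_zero hf hρ hI' hx]
    · change M / ρ * block g c (Function.update f m (deriv (f m))) ρ M x = 0
      rw [hz, mul_zero]

/-- Ergodicity covers `1 < M` only; the value `M = 1` is needed for the generation `0`. -/
lemma measurePreserving_nsmul_circle (hM : 0 < M) :
    MeasurePreserving (fun y : UnitAddCircle => M • y) volume volume := by
  rcases Nat.eq_or_lt_of_le (Nat.succ_le_of_lt hM) with h | h
  · rw [← h]
    simp only [Nat.succ_eq_add_one, zero_add, one_smul]
    exact MeasurePreserving.id (volume : Measure UnitAddCircle)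
  · exact (AddCircle.ergodic_nsmul h).toMeasurePreserving

/-- By Fubini: at a fixed time the slice is a product of preimages of arcs of length at most `4 * ρ`
under multiplication by `M`. This map preserves the measure, so the bound does not depend on `M`,
however many balls there are. -/
lemma volume_blockSupport_le (I : Set UnitAddCircle) (hc : ∀ m, Continuous (c m)) (hρ : 0 < ρ)
    (hM : 0 < M) : volume (blockSupport I c ρ M) ≤ ENNReal.ofReal ((4 * ρ) ^ n) := by
  set E : Set (UnitAddCircle × (Fin n → UnitAddCircle)) :=
    {q | ∀ m : Fin n, ‖M • q.2 m - ((c m q.1 : ℝ) : UnitAddCircle)‖ ≤ 2 * ρ} with hE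
  have hEc : IsClosed E := by
    rw [hE, Set.ofPred_forall]
    refine isClosed_iInter fun m => isClosed_le (Continuous.norm ?_) continuous_const
    refine ((continuous_nsmul M).comp ((continuous_apply m).comp continuous_snd)).sub ?_
    exact (AddCircle.continuous_mk' (1 : ℝ)).comp ((hc m).comp continuous_fst)
  have hsub : blockSupport I c ρ M ⊆
      (MeasurableEquiv.piFinSuccAbove (fun _ : Fin (n + 1) => UnitAddCircle) 0) ⁻¹' E := by
    intro x hx m
    exact hx.2 m
  refine (measure_mono hsub).trans ?_
  rw [(volume_preserving_piFinSuccAbove (fun _ : Fin (n + 1) => UnitAddCircle) 0).measure_preimage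
    hEc.measurableSet.nullMeasurableSet]
  change (volume.prod volume) E ≤ _
  rw [Measure.prod_apply hEc.measurableSet]
  calc ∫⁻ s, volume (Prod.mk s ⁻¹' E)
      ≤ ∫⁻ _s : UnitAddCircle, ENNReal.ofReal ((4 * ρ) ^ n) := by
        refine lintegral_mono fun s => ?_
        have e : Prod.mk s ⁻¹' E = Set.pi univ fun m : Fin n =>
            (fun y : UnitAddCircle => M • y) ⁻¹'
              Metric.closedBall ((c m s : ℝ) : UnitAddCircle) (2 * ρ) := by
          ext y
          simp [hE, dist_eq_norm]
        rw [e, volume_pi_pi]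
        calc ∏ m : Fin n, volume ((fun y : UnitAddCircle => M • y) ⁻¹'
              Metric.closedBall ((c m s : ℝ) : UnitAddCircle) (2 * ρ))
            ≤ ∏ _m : Fin n, ENNReal.ofReal (4 * ρ) := by
              refine Finset.prod_le_prod' fun m _ => ?_
              rw [(measurePreserving_nsmul_circle hM).measure_preimage
                Metric.isClosed_closedBall.measurableSet.nullMeasurableSet,
                AddCircle.volume_closedBall]
              refine ENNReal.ofReal_le_ofReal ((min_le_right _ _).trans (le_of_eq (by ring)))
          _ = ENNReal.ofReal ((4 * ρ) ^ n) := by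
              rw [ENNReal.ofReal_pow (by positivity)]; simp
    _ = _ := by simp

end Block

/-! ### Smooth clocks -/

/-- A smooth function supported in `[1/2, 7/8]`. -/
structure IsPulse (f : ℝ → ℝ) : Prop where
  contDiff : ContDiff ℝ ∞ f
  eq_zero : ∀ t, t ∉ Icc (1 / 2 : ℝ) (7 / 8) → f t = 0

namespace IsPulse

variable {f : ℝ → ℝ}

lemma deriv (h : IsPulse f) : IsPulse (deriv f) := by
  refine ⟨(contDiff_infty_iff_deriv.1 h.contDiff).2, fun t ht => ?_⟩
  have : f =ᶠ[nhds t] fun _ => 0 := by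
    filter_upwards [isClosed_Icc.isOpen_compl.mem_nhds ht] with s hs using h.eq_zero s hs
  rw [this.deriv_eq]; simp

lemma hasDerivAt (h : IsPulse f) (x : ℝ) : HasDerivAt f (_root_.deriv f x) x :=
  (h.contDiff.differentiable (by simp)).differentiableAt.hasDerivAt

lemma exists_bound (h : IsPulse f) : ∃ K, ∀ z, |f z| ≤ K := by
  have hc : HasCompactSupport f := HasCompactSupport.of_support_subset_isCompact
    (isCompact_Icc (a := (1 / 2 : ℝ)) (b := 7 / 8)) fun t ht => by
      by_contra h'; exact ht (h.eq_zero t h')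
  exact hc.exists_bound_of_continuous h.contDiff.continuous

end IsPulse

/-- The points of the circle at which the `i`-th generation is active. -/
def activeSet (i : ℕ) : Set UnitAddCircle :=
  (fun s : ℝ => (s : UnitAddCircle)) '' {s : ℝ | (2 : ℝ) ^ i * s ∈ Icc (1 / 2 : ℝ) (7 / 8)}

/-- The periodic function that is `s ↦ f (2 ^ i * s)` on `[0, 1]`. -/
def clock (f : ℝ → ℝ) (i : ℕ) : UnitAddCircle → ℝ := periodize fun s => f (2 ^ i * s)

section Clock

variable {f : ℝ → ℝ} {i : ℕ}

lemma clock_coe (hf : IsPulse f) {s : ℝ} (hs : s ∈ Icc (0 : ℝ) 1) :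
    clock f i (s : UnitAddCircle) = f (2 ^ i * s) := by
  rw [clock, periodize_coe]
  -- At `s = 1` the fractional part jumps to `0`, but the pulse vanishes both at `0` and at `2 ^ i`.
  rcases eq_or_lt_of_le hs.2 with h | h
  · have h1 : (1 : ℝ) ≤ 2 ^ i := one_le_pow₀ (by norm_num)
    rw [h, Int.fract_one, hf.eq_zero (2 ^ i * 0) (by norm_num),
      hf.eq_zero (2 ^ i * 1) fun h' => by linarith [h'.2]]
  · rw [Int.fract_eq_self.2 ⟨hs.1, h⟩]

lemma hasCircleDeriv_clock (hf : IsPulse f) (i : ℕ) :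
    HasCircleDeriv (clock f i) (fun a => 2 ^ i * clock (deriv f) i a) := by
  have h1 : ∀ x, HasDerivAt (fun s => f (2 ^ i * s)) (2 ^ i * deriv f (2 ^ i * x)) x := by
    intro x
    have h2 : HasDerivAt (fun s : ℝ => (2 : ℝ) ^ i * s) (2 ^ i) x := by
      simpa using (hasDerivAt_id x).const_mul ((2 : ℝ) ^ i)
    have h3 := HasDerivAt.comp x (hf.hasDerivAt (2 ^ i * x)) h2
    rw [mul_comm]
    exact h3
  have hp : (1 : ℝ) ≤ 2 ^ i := one_le_pow₀ (by norm_num)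
  refine hasCircleDeriv_periodize (ε := min (1 / 16) (1 / (4 * 2 ^ i))) h1 (by positivity)
    (fun t ht => hf.eq_zero _ fun h' => ?_) (fun t ht => hf.eq_zero _ fun h' => ?_)
  · have h4 : t ≤ 1 / (4 * 2 ^ i) := ht.trans (min_le_right _ _)
    have h5 : 2 ^ i * t ≤ 1 / 4 := by
      calc 2 ^ i * t ≤ 2 ^ i * (1 / (4 * 2 ^ i)) := by gcongr
        _ = 1 / 4 := by field_simp
    linarith [h'.1]
  · have h4 : 15 / 16 ≤ t := by linarith [min_le_left (1 / 16 : ℝ) (1 / (4 * 2 ^ i))]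
    have h5 : (15 / 16 : ℝ) ≤ 2 ^ i * t := by nlinarith
    linarith [h'.2]

lemma clock_eq_zero (hf : IsPulse f) {a : UnitAddCircle} (ha : a ∉ activeSet i) :
    clock f i a = 0 := by
  obtain ⟨r, rfl⟩ := QuotientAddGroup.mk_surjective a
  change periodize _ (r : UnitAddCircle) = 0
  rw [periodize_coe]
  refine hf.eq_zero _ fun h => ha ⟨Int.fract r, h, ?_⟩
  change ((Int.fract r : ℝ) : UnitAddCircle) = (r : UnitAddCircle)
  rw [← Int.self_sub_floor, AddCircle.coe_sub]
  have : (((⌊r⌋ : ℤ) : ℝ) : UnitAddCircle) = 0 := by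
    rw [AddCircle.coe_eq_zero_iff]; exact ⟨⌊r⌋, by simp⟩
  rw [this, sub_zero]

lemma abs_clock_le {K : ℝ} (hK : ∀ t, |f t| ≤ K) (a : UnitAddCircle) : |clock f i a| ≤ K := by
  obtain ⟨r, rfl⟩ := QuotientAddGroup.mk_surjective a
  exact hK _

/-- If `2 ^ i * s ≥ 1 / 2` and `i < j`, then `2 ^ j * s ≥ 1 > 7 / 8`. -/
lemma disjoint_activeSet {i j : ℕ} (hij : i ≠ j) : Disjoint (activeSet i) (activeSet j) := by
  wlog h : i < j generalizing i j
  · exact (this hij.symm (by omega)).symm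
  rw [Set.disjoint_left]
  have hunit : ∀ (i : ℕ) (s : ℝ), (2 : ℝ) ^ i * s ∈ Icc (1 / 2 : ℝ) (7 / 8) →
      s ∈ Ico (0 : ℝ) (0 + 1) := by
    intro i s hs
    have hp : (1 : ℝ) ≤ 2 ^ i := one_le_pow₀ (by norm_num)
    have h0 : 0 ≤ s := by
      by_contra hneg
      push Not at hneg
      nlinarith [hs.1]
    refine ⟨h0, ?_⟩
    nlinarith [hs.2]
  rintro a ⟨s, hs, rfl⟩ ⟨t, ht, hst⟩
  have e : t = s := (AddCircle.coe_eq_coe_iff_of_mem_Ico (hunit j t ht) (hunit i s hs)).1 hst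
  subst e
  have h2 : (2 : ℝ) ^ (i + 1) ≤ 2 ^ j := pow_le_pow_right₀ (by norm_num) h
  have h0 := (hunit i t hs).1
  have h3 : (2 : ℝ) ^ (i + 1) * t ≤ 2 ^ j * t := mul_le_mul_of_nonneg_right h2 h0
  rw [pow_succ] at h3
  linarith [hs.1, ht.2]

end Clock

/-- The smooth step from `0` to `1` along which the coordinate `m` of the centres moves; the
coordinate `0` moves before the others. -/
def rise {n : ℕ} (m : Fin (n + 2)) (t : ℝ) : ℝ :=
  Real.smoothTransition (16 * t - if m = 0 then 17 / 2 else 21 / 2)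

/-- A pulse that agrees with `rise m` up to the time `3/4`. -/
def risePulse {n : ℕ} (m : Fin (n + 2)) (t : ℝ) : ℝ :=
  rise m t * (1 - Real.smoothTransition (16 * t - 25 / 2))

section Rise

variable {n : ℕ} (m : Fin (n + 2))

lemma contDiff_rise : ContDiff ℝ ∞ (rise m) :=
  Real.smoothTransition.contDiff.comp (by fun_prop)

lemma rise_of_le {t : ℝ} (ht : t ≤ 1 / 2) : rise m t = 0 :=
  Real.smoothTransition.zero_of_nonpos (by split_ifs <;> linarith)

lemma rise_of_ge {t : ℝ} (ht : 3 / 4 ≤ t) : rise m t = 1 :=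
  Real.smoothTransition.one_of_one_le (by split_ifs <;> linarith)

/-- The coordinate `0` moves during `[17/32, 19/32]` and the others during `[21/32, 23/32]`; the
time `5/8` separates the two stages. -/
lemma rise_zero_of_ge {t : ℝ} (ht : 5 / 8 ≤ t) : rise (0 : Fin (n + 2)) t = 1 :=
  Real.smoothTransition.one_of_one_le (by simp only [if_true]; linarith)

lemma rise_of_ne_zero_of_le {m : Fin (n + 2)} (hm : m ≠ 0) {t : ℝ} (ht : t ≤ 5 / 8) :
    rise m t = 0 :=
  Real.smoothTransition.zero_of_nonpos (by simp only [hm, if_false]; linarith)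

lemma rise_mem (t : ℝ) : rise m t ∈ Icc (0 : ℝ) 1 :=
  ⟨Real.smoothTransition.nonneg _, Real.smoothTransition.le_one _⟩

lemma hasDerivAt_rise (t : ℝ) : HasDerivAt (rise m) (deriv (rise m) t) t :=
  ((contDiff_rise m).differentiable (by simp)).differentiableAt.hasDerivAt

lemma deriv_rise_eq_zero {t : ℝ} (ht : t ∉ Icc (1 / 2 : ℝ) (3 / 4)) : deriv (rise m) t = 0 := by
  rw [mem_Icc, not_and_or, not_le, not_le] at ht
  rcases ht with ht | ht
  · have : rise m =ᶠ[nhds t] fun _ => 0 := by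
      filter_upwards [gt_mem_nhds ht] with s hs using rise_of_le m hs.le
    rw [this.deriv_eq]; simp
  · have : rise m =ᶠ[nhds t] fun _ => 1 := by
      filter_upwards [lt_mem_nhds ht] with s hs using rise_of_ge m hs.le
    rw [this.deriv_eq]; simp

lemma isPulse_deriv_rise : IsPulse (deriv (rise m)) :=
  ⟨(contDiff_infty_iff_deriv.1 (contDiff_rise m)).2, fun _ ht =>
    deriv_rise_eq_zero m fun h => ht ⟨h.1, h.2.trans (by norm_num)⟩⟩

lemma isPulse_risePulse : IsPulse (risePulse m) := by
  refine ⟨(contDiff_rise m).mul (contDiff_const.sub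
    (Real.smoothTransition.contDiff.comp (by fun_prop))), fun t ht => ?_⟩
  rw [mem_Icc, not_and_or, not_le, not_le] at ht
  rcases ht with ht | ht
  · rw [risePulse, rise_of_le m ht.le, zero_mul]
  · rw [risePulse, Real.smoothTransition.one_of_one_le (by linarith), sub_self, mul_zero]

/-- Periodicity in time forces the centres to return to their initial places. They do so after
`3/4`, when the velocity amplitude `deriv (rise k)` is already zero, and up to then the pulse is the
true motion. -/
lemma risePulse_of_le {t : ℝ} (ht : t ≤ 3 / 4) : risePulse m t = rise m t := by
  rw [risePulse, Real.smoothTransition.zero_of_nonpos (by linarith), sub_zero, mul_one]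

end Rise

/-! ### The profile of a translated ball -/

/-- A smooth bump that is `1` on `[-1, 1]`. -/
def unitBump : ContDiffBump (0 : ℝ) := ⟨1, 3 / 2, one_pos, by norm_num⟩

/-- The function `z ↦ z` near `[-1, 1]`, cut off. -/
def linearBump (z : ℝ) : ℝ := z * unitBump z

lemma isProfile_unitBump : IsProfile unitBump := by
  refine ⟨unitBump.contDiff, ?_⟩
  rw [unitBump.tsupport_eq]
  exact Metric.closedBall_subset_ball (by norm_num [unitBump])

lemma isProfile_linearBump : IsProfile linearBump := by
  refine ⟨contDiff_id.mul unitBump.contDiff, ?_⟩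
  exact (tsupport_mul_subset_right (f := fun z : ℝ => z) (g := unitBump)).trans
    isProfile_unitBump.tsupport_subset

lemma unitBump_eq_one {z : ℝ} (hz : |z| < 1) : unitBump z = 1 :=
  unitBump.one_of_mem_closedBall (by simpa [unitBump] using hz.le)

lemma unitBump_eventuallyEq {z : ℝ} (hz : |z| < 1) : unitBump =ᶠ[nhds z] fun _ => (1 : ℝ) := by
  filter_upwards [continuous_abs.continuousAt.eventually (gt_mem_nhds hz)] with s hs
    using unitBump_eq_one hs

lemma deriv_unitBump_eq_zero {z : ℝ} (hz : |z| < 1) : deriv unitBump z = 0 := by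
  rw [(unitBump_eventuallyEq hz).deriv_eq]; simp

lemma deriv_linearBump_eq_one {z : ℝ} (hz : |z| < 1) : deriv linearBump z = 1 := by
  have : linearBump =ᶠ[nhds z] fun z => z := by
    filter_upwards [unitBump_eventuallyEq hz] with s hs
    rw [linearBump, hs, mul_one]
  rw [this.deriv_eq]; simp

section Profiles

variable {n : ℕ}

/-- The coordinate that is paired with `k` in the stream function of the `k`-th motion. -/
def partner (k : Fin (n + 2)) : Fin (n + 2) := if k = 0 then 1 else 0

lemma partner_ne (k : Fin (n + 2)) : partner k ≠ k := by
  unfold partner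
  split_ifs with h
  · rw [h]; exact one_ne_zero
  · exact fun h' => h h'.symm

/-- The factors of the component `k` of the field that translates a ball in direction `k`. -/
def mainProfile (k m : Fin (n + 2)) : ℝ → ℝ :=
  if m = partner k then deriv linearBump else unitBump

/-- The factors of the component `partner k` of the field that translates a ball in
direction `k`. -/
def sideProfile (k m : Fin (n + 2)) : ℝ → ℝ :=
  if m = partner k then linearBump else if m = k then deriv unitBump else unitBump

lemma isProfile_mainProfile (k m : Fin (n + 2)) : IsProfile (mainProfile k m) := by
  unfold mainProfile
  split_ifs
  exacts [isProfile_linearBump.deriv, isProfile_unitBump]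

lemma isProfile_sideProfile (k m : Fin (n + 2)) : IsProfile (sideProfile k m) := by
  unfold sideProfile
  split_ifs
  exacts [isProfile_linearBump, isProfile_unitBump.deriv, isProfile_unitBump]

/-- The two components are the derivatives of one stream function. -/
lemma update_mainProfile (k : Fin (n + 2)) :
    Function.update (mainProfile k) k (deriv (mainProfile k k))
      = Function.update (sideProfile k) (partner k) (deriv (sideProfile k (partner k))) := by
  have hne := partner_ne k
  funext m
  by_cases h1 : m = k
  · subst h1
    simp [mainProfile, sideProfile, hne.symm]
  · by_cases h2 : m = partner k
    · subst h2
      simp [mainProfile, sideProfile, hne]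
    · simp [mainProfile, sideProfile, h1, h2]

/-- Together with `sideProfile_self_eq_zero`: on the inner ball the stream function is linear in the
partner coordinate, so the field there is a rigid translation in direction `k`. -/
lemma mainProfile_eq_one (k m : Fin (n + 2)) {z : ℝ} (hz : |z| < 1) : mainProfile k m z = 1 := by
  unfold mainProfile
  split_ifs
  exacts [deriv_linearBump_eq_one hz, unitBump_eq_one hz]

lemma sideProfile_self_eq_zero (k : Fin (n + 2)) {z : ℝ} (hz : |z| < 1) :
    sideProfile k k z = 0 := by
  simp [sideProfile, (partner_ne k).symm, deriv_unitBump_eq_zero hz]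

end Profiles

/-- A common bound for the finitely many one-variable functions in the construction. -/
lemma exists_common_bound (n : ℕ) : ∃ K : ℝ, 1 ≤ K ∧
    (∀ (k m : Fin (n + 2)) (z : ℝ), |mainProfile k m z| ≤ K) ∧
    (∀ (k m : Fin (n + 2)) (z : ℝ), |deriv (mainProfile k m) z| ≤ K) ∧
    (∀ (k m : Fin (n + 2)) (z : ℝ), |sideProfile k m z| ≤ K) ∧
    (∀ (k m : Fin (n + 2)) (z : ℝ), |deriv (sideProfile k m) z| ≤ K) ∧
    (∀ (m : Fin (n + 2)) (t : ℝ), |deriv (rise m) t| ≤ K) ∧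
    (∀ (m : Fin (n + 2)) (t : ℝ), |deriv (deriv (rise m)) t| ≤ K) ∧
    (∀ (m : Fin (n + 2)) (t : ℝ), |deriv (risePulse m) t| ≤ K) := by
  have unif : ∀ {ι : Type} [Fintype ι] (F : ι → ℝ → ℝ), (∀ i, ∃ K, ∀ z, |F i z| ≤ K) →
      ∃ K, ∀ i z, |F i z| ≤ K := by
    intro ι _ F h
    choose K hK using h
    refine ⟨∑ i, |K i|, fun i z => (hK i z).trans ((le_abs_self _).trans ?_)⟩
    exact Finset.single_le_sum (f := fun i => |K i|) (fun _ _ => abs_nonneg _) (Finset.mem_univ i)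
  obtain ⟨K₁, h₁⟩ := unif (fun q : Fin (n + 2) × Fin (n + 2) => mainProfile q.1 q.2)
    fun q => (isProfile_mainProfile _ _).exists_bound
  obtain ⟨K₂, h₂⟩ := unif (fun q : Fin (n + 2) × Fin (n + 2) => deriv (mainProfile q.1 q.2))
    fun q => (isProfile_mainProfile _ _).deriv.exists_bound
  obtain ⟨K₃, h₃⟩ := unif (fun q : Fin (n + 2) × Fin (n + 2) => sideProfile q.1 q.2)
    fun q => (isProfile_sideProfile _ _).exists_bound
  obtain ⟨K₄, h₄⟩ := unif (fun q : Fin (n + 2) × Fin (n + 2) => deriv (sideProfile q.1 q.2))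
    fun q => (isProfile_sideProfile _ _).deriv.exists_bound
  obtain ⟨K₅, h₅⟩ := unif (fun m : Fin (n + 2) => deriv (rise m))
    fun m => (isPulse_deriv_rise m).exists_bound
  obtain ⟨K₆, h₆⟩ := unif (fun m : Fin (n + 2) => deriv (deriv (rise m)))
    fun m => (isPulse_deriv_rise m).deriv.exists_bound
  obtain ⟨K₇, h₇⟩ := unif (fun m : Fin (n + 2) => deriv (risePulse m))
    fun m => (isPulse_risePulse m).deriv.exists_bound
  have p₁ := (abs_nonneg _).trans (h₁ (0, 0) 0)
  have p₂ := (abs_nonneg _).trans (h₂ (0, 0) 0)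
  have p₃ := (abs_nonneg _).trans (h₃ (0, 0) 0)
  have p₄ := (abs_nonneg _).trans (h₄ (0, 0) 0)
  have p₅ := (abs_nonneg _).trans (h₅ 0 0)
  have p₆ := (abs_nonneg _).trans (h₆ 0 0)
  have p₇ := (abs_nonneg _).trans (h₇ 0 0)
  refine ⟨1 + K₁ + K₂ + K₃ + K₄ + K₅ + K₆ + K₇, by linarith, fun k m z => ?_, fun k m z => ?_,
    fun k m z => ?_, fun k m z => ?_, fun m t => ?_, fun m t => ?_, fun m t => ?_⟩
  · exact (h₁ (k, m) z).trans (by linarith)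
  · exact (h₂ (k, m) z).trans (by linarith)
  · exact (h₃ (k, m) z).trans (by linarith)
  · exact (h₄ (k, m) z).trans (by linarith)
  · exact (h₅ m t).trans (by linarith)
  · exact (h₆ m t).trans (by linarith)
  · exact (h₇ m t).trans (by linarith)

/-! ### The generations of moving balls -/

section Field

variable {n : ℕ} (N : ℕ) (η : ℝ) (i : ℕ)

/-- The labels of the balls that move in one cell: the digits of their target, and the family. -/
abbrev Label (n N : ℕ) : Type := (Fin (n + 2) → Fin N) × Fin 2

/-- The distance between neighbouring balls of the `i`-th generation after the contraction, relative
to the size of the cell. -/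
def gap : ℝ := η * (η * N) ^ i

/-- The total displacement of a ball of the `i`-th generation, relative to the size of the cell. -/
def displacement (q : Label n N) (m : Fin (n + 2)) : ℝ :=
  (gap N η i - 1 / N) * ((q.1 m : ℕ) : ℝ) + ((q.2 : ℕ) : ℝ) / 2 * (1 - 1 / N)

/-- The centre of a ball of the `i`-th generation, relative to the size of the cell, when the
fraction `θ` of the displacement is done. -/
def centre (q : Label n N) (m : Fin (n + 2)) (θ : ℝ) : ℝ :=
  (((q.1 m : ℕ) : ℝ) + ((q.2 : ℕ) : ℝ) / 2) / N + θ * displacement N η i q m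

/-- The centre as a function of the periodic time. -/
def centreClock (q : Label n N) (m : Fin (n + 2)) (a : UnitAddCircle) : ℝ :=
  centre N η i q m (clock (risePulse m) i a)

/-- The derivative of `centreClock`. -/
def centreClockDeriv (q : Label n N) (m : Fin (n + 2)) (a : UnitAddCircle) : ℝ :=
  displacement N η i q m * (2 ^ i * clock (deriv (risePulse m)) i a)

/-- The component `k` of the field that moves the ball `q` in direction `k`. -/
def mainBlock (q : Label n N) (k : Fin (n + 2)) : Torus (n + 3) → ℝ :=
  block (clock (deriv (rise k)) i) (centreClock N η i q) (mainProfile k) (gap N η i / 4) (N ^ i)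

/-- The component `partner k` of the field that moves the ball `q` in direction `k`, with the
opposite sign. -/
def sideBlock (q : Label n N) (k : Fin (n + 2)) : Torus (n + 3) → ℝ :=
  block (clock (deriv (rise k)) i) (centreClock N η i q) (sideProfile k) (gap N η i / 4) (N ^ i)

/-- The partial derivatives of `mainBlock`. -/
def mainBlockDeriv (q : Label n N) (k : Fin (n + 2)) : Fin (n + 3) → Torus (n + 3) → ℝ :=
  blockDeriv (clock (deriv (rise k)) i) (fun a => 2 ^ i * clock (deriv (deriv (rise k))) i a)
    (centreClock N η i q) (centreClockDeriv N η i q) (mainProfile k) (gap N η i / 4) (N ^ i)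

/-- The partial derivatives of `sideBlock`. -/
def sideBlockDeriv (q : Label n N) (k : Fin (n + 2)) : Fin (n + 3) → Torus (n + 3) → ℝ :=
  blockDeriv (clock (deriv (rise k)) i) (fun a => 2 ^ i * clock (deriv (deriv (rise k))) i a)
    (centreClock N η i q) (centreClockDeriv N η i q) (sideProfile k) (gap N η i / 4) (N ^ i)

/-- The component `j` of the velocity field of the `i`-th generation. -/
def generation (j : Fin (n + 3)) (x : Torus (n + 3)) : ℝ :=
  (2 / N) ^ i * ∑ q : Label n N, ∑ k : Fin (n + 2), displacement N η i q k *
    ((if j = k.succ then 1 else 0) * mainBlock N η i q k x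
      + (if j = (partner k).succ then -1 else 0) * sideBlock N η i q k x)

/-- The partial derivatives of `generation`. -/
def generationDeriv (j l : Fin (n + 3)) (x : Torus (n + 3)) : ℝ :=
  (2 / N) ^ i * ∑ q : Label n N, ∑ k : Fin (n + 2), displacement N η i q k *
    ((if j = k.succ then 1 else 0) * mainBlockDeriv N η i q k l x
      + (if j = (partner k).succ then -1 else 0) * sideBlockDeriv N η i q k l x)

/-- A set outside of which the `i`-th generation vanishes. -/
def generationSupport (n : ℕ) : Set (Torus (n + 3)) :=
  ⋃ q : Label n N, blockSupport (activeSet i) (centreClock N η i q) (gap N η i / 4) (N ^ i)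

variable {N η i}

/-- Hence `x 0` advances at the constant speed `lam` and can serve as a clock. -/
lemma generation_zero (x : Torus (n + 3)) : generation N η i 0 x = 0 := by
  simp [generation, (Fin.succ_ne_zero _).symm]

/-- For each ball and direction the two components are derivatives of one stream function with
opposite signs, so the mixed second derivatives cancel. The dependence on `x 0` does no harm because
the component `0` is zero. -/
lemma sum_generationDeriv (x : Torus (n + 3)) : ∑ j, generationDeriv N η i j j x = 0 := by
  unfold generationDeriv
  rw [← Finset.mul_sum, Finset.sum_comm]
  have : ∀ q : Label n N, ∑ j : Fin (n + 3), ∑ k : Fin (n + 2), displacement N η i q k *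
      ((if j = k.succ then 1 else 0) * mainBlockDeriv N η i q k j x
      + (if j = (partner k).succ then -1 else 0) * sideBlockDeriv N η i q k j x) = 0 := by
    intro q
    rw [Finset.sum_comm]
    refine Finset.sum_eq_zero fun k _ => ?_
    rw [← Finset.mul_sum, Finset.sum_add_distrib]
    simp only [ite_mul, one_mul, zero_mul, neg_mul, Finset.sum_ite_eq', Finset.mem_univ, if_true]
    have e : mainBlockDeriv N η i q k k.succ x = sideBlockDeriv N η i q k (partner k).succ x := by
      simp only [mainBlockDeriv, sideBlockDeriv, blockDeriv, Fin.cases_succ]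
      rw [update_mainProfile]
    rw [e]; ring
  rw [Finset.sum_eq_zero fun q _ => this q, mul_zero]

lemma gap_pos (hN : 0 < N) (hη : 0 < η) : 0 < gap N η i := by
  unfold gap; positivity

lemma gap_le (hη : 0 < η) (hηN : η * N ≤ 1 / 8) : gap N η i ≤ η := by
  have : (η * N) ^ i ≤ 1 := pow_le_one₀ (by positivity) (by linarith)
  unfold gap
  nlinarith

lemma abs_displacement_le (hN : 0 < N) (hη : 0 < η) (hηN : η * N ≤ 1 / 8) (q : Label n N)
    (m : Fin (n + 2)) : |displacement N η i q m| ≤ 2 := by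
  have hN' : (0 : ℝ) < N := by exact_mod_cast hN
  have h1 : gap N η i * N ≤ 1 / 8 :=
    (mul_le_mul_of_nonneg_right (gap_le hη hηN) hN'.le).trans hηN
  have h0 := gap_pos (i := i) hN hη
  have h2 : ((q.1 m : ℕ) : ℝ) ≤ N := by exact_mod_cast (q.1 m).2.le
  have h3 : (0 : ℝ) ≤ ((q.1 m : ℕ) : ℝ) := Nat.cast_nonneg _
  have h4 : ((q.2 : ℕ) : ℝ) ≤ 1 := by exact_mod_cast (by omega : (q.2 : ℕ) ≤ 1)
  have h5 : (0 : ℝ) ≤ ((q.2 : ℕ) : ℝ) := Nat.cast_nonneg _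
  have h6 : 1 / (N : ℝ) ≤ 1 := by
    rw [div_le_one hN']; exact_mod_cast hN
  have h7 : 0 ≤ 1 / (N : ℝ) := by positivity
  have h8 : 1 / (N : ℝ) * ((q.1 m : ℕ) : ℝ) ≤ 1 := by
    rw [one_div, inv_mul_le_iff₀ hN', mul_one]; exact h2
  have h9 : gap N η i * ((q.1 m : ℕ) : ℝ) ≤ 1 :=
    (mul_le_mul_of_nonneg_left h2 h0.le).trans (by linarith)
  unfold displacement
  rw [abs_le]
  constructor <;> nlinarith [mul_nonneg h7 h3, mul_nonneg h0.le h3]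

lemma hasCircleDeriv_centreClock (q : Label n N) (m : Fin (n + 2)) :
    HasCircleDeriv (centreClock N η i q m) (centreClockDeriv N η i q m) := by
  intro x
  have h := (hasCircleDeriv_clock (isPulse_risePulse m) i x).mul_const (displacement N η i q m)
  have h2 := h.const_add ((((q.1 m : ℕ) : ℝ) + ((q.2 : ℕ) : ℝ) / 2) / N)
  rw [mul_comm] at h2
  exact h2

lemma continuous_clock {f : ℝ → ℝ} (hf : IsPulse f) : Continuous (clock f i) :=
  (hasCircleDeriv_clock hf i).continuous

lemma continuous_centreClockDeriv (q : Label n N) (m : Fin (n + 2)) :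
    Continuous (centreClockDeriv N η i q m) :=
  ((continuous_clock (isPulse_risePulse m).deriv).const_mul _).const_mul _

lemma disjoint_generationSupport :
    Pairwise (Function.onFun Disjoint fun i => generationSupport N η i n) := by
  intro i j hij
  rw [Function.onFun, Set.disjoint_left]
  intro x hx hx'
  obtain ⟨q, hq⟩ := mem_iUnion.1 hx
  obtain ⟨q', hq'⟩ := mem_iUnion.1 hx'
  exact Set.disjoint_left.1 (disjoint_activeSet hij) hq.1 hq'.1

lemma volume_generationSupport_le (hN : 0 < N) (hη : 0 < η) :
    volume (generationSupport N η i n) ≤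
      ENNReal.ofReal (Fintype.card (Label n N) * η ^ (n + 2) * ((η * N) ^ (n + 2)) ^ i) := by
  have hN' : (0 : ℝ) < N := by exact_mod_cast hN
  have hρ : 0 < gap N η i / 4 := by linarith [gap_pos (i := i) hN hη]
  refine (measure_iUnion_fintype_le _ _).trans ?_
  calc ∑ q : Label n N, volume (blockSupport (activeSet i) (centreClock N η i q)
        (gap N η i / 4) (N ^ i))
      ≤ ∑ _q : Label n N, ENNReal.ofReal ((4 * (gap N η i / 4)) ^ (n + 2)) :=
        Finset.sum_le_sum fun q _ => volume_blockSupport_le _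
          (fun m => (hasCircleDeriv_centreClock q m).continuous) hρ (by positivity)
    _ = _ := by
        rw [Finset.sum_const, Finset.card_univ, nsmul_eq_mul, ← ENNReal.ofReal_natCast,
          ← ENNReal.ofReal_mul (by positivity)]
        congr 1
        rw [mul_div_cancel₀ _ (by norm_num : (4 : ℝ) ≠ 0), gap, mul_pow, ← pow_mul, ← pow_mul,
          mul_comm i (n + 2)]
        ring

/-- The generations are uniformly controlled by geometric sequences. -/
lemma exists_isGeometric_generation (n : ℕ) (hN : 3 ≤ N) (hη : 0 < η) (hηN : η * N ≤ 1 / 8) :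
    ∃ C : ℝ, ∀ j : Fin (n + 3), IsGeometric (fun i => generation N η i j)
      (fun i => generationDeriv N η i j) (fun i => generationSupport N η i n) C
      (2 / N) (2 / (N * η)) ((η * N) ^ (n + 2)) := by
  obtain ⟨K, hK1, hm, hm', hs, hs', hr, hr', hp⟩ := exists_common_bound n
  have hN0 : 0 < N := by omega
  have hN' : (3 : ℝ) ≤ N := by exact_mod_cast hN
  have hNpos : (0 : ℝ) < N := by linarith
  have hK0 : 0 ≤ K := by linarith
  set A : ℝ := K * K ^ (n + 2) with hA
  -- The factor `4 / η` comes from `N ^ i / (gap / 4) = (4 / η) * (1 / η) ^ i`.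
  set B : ℝ := (A + ((n + 2 : ℕ) * (2 * K) + 1) * A) * (4 / η) with hB
  have hA0 : 0 ≤ A := by positivity
  have hB0 : 0 ≤ B := by positivity
  have hblock : ∀ (i : ℕ) (q : Label n N) (k : Fin (n + 2)) (f : Fin (n + 2) → ℝ → ℝ),
      (∀ m, IsProfile (f m)) → (∀ m z, |f m z| ≤ K) → (∀ m z, |deriv (f m) z| ≤ K) →
      IsLocalized (block (clock (deriv (rise k)) i) (centreClock N η i q) f (gap N η i / 4) (N ^ i))
        (blockDeriv (clock (deriv (rise k)) i) (fun a => 2 ^ i * clock (deriv (deriv (rise k))) i a)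
          (centreClock N η i q) (centreClockDeriv N η i q) f (gap N η i / 4) (N ^ i))
        A (B * (1 / η) ^ i) (generationSupport N η i n) := by
    intro i q k f hf hfK hfK'
    have hg0 := gap_pos (i := i) hN0 hη
    have hgη := gap_le (i := i) hη hηN
    have hη1 : η ≤ 1 / 8 := by nlinarith
    have h2i : (0 : ℝ) < 2 ^ i := by positivity
    refine (isLocalized_block (A := K) (A' := 2 ^ i * K) (Q := 2 * (2 ^ i * K)) (K := K)
      (hasCircleDeriv_clock (isPulse_deriv_rise k) i)
      ((continuous_clock (isPulse_deriv_rise k).deriv).const_mul _)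
      (fun m => hasCircleDeriv_centreClock q m) (fun m => continuous_centreClockDeriv q m)
      hf (by linarith) (by linarith) (I := activeSet i)
      (fun a ha => clock_eq_zero (isPulse_deriv_rise k) ha)
      (fun a ha => by rw [clock_eq_zero (isPulse_deriv_rise k).deriv ha, mul_zero])
      (fun a => abs_clock_le (hr k) a)
      (fun a => by
        rw [abs_mul, abs_of_pos h2i]
        exact mul_le_mul_of_nonneg_left (abs_clock_le (hr' k) a) h2i.le)
      (fun m a => by
        rw [centreClockDeriv, abs_mul, abs_mul, abs_of_pos h2i]
        exact mul_le_mul (abs_displacement_le hN0 hη hηN q m)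
          (mul_le_mul_of_nonneg_left (abs_clock_le (hp m) a) h2i.le) (by positivity)
          (by norm_num)) hfK hfK').mono le_rfl ?_
      (subset_iUnion (fun q : Label n N => blockSupport (activeSet i) (centreClock N η i q)
        (gap N η i / 4) (N ^ i)) q)
    -- Time derivatives cost `2 ^ i`; the spatial frequency `N ^ i` absorbs them.
    have h2N : (2 : ℝ) ^ i ≤ N ^ i := by
      have : (2 : ℝ) ≤ N := by linarith
      gcongr
    have e1 : (1 / η) ^ i * (4 / η) = N ^ i / (gap N η i / 4) := by
      have : (N : ℝ) ^ i ≠ 0 := by positivity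
      rw [gap, mul_pow, one_div, inv_pow]
      field_simp
    have h1 : (N : ℝ) ^ i ≤ N ^ i / (gap N η i / 4) := by
      rw [le_div_iff₀ (by linarith)]
      have : (0 : ℝ) < N ^ i := by positivity
      nlinarith
    have e2 : B * (1 / η) ^ i
        = (A + ((n + 2 : ℕ) * (2 * K) + 1) * A) * (N ^ i / (gap N η i / 4)) := by
      rw [← e1, hB]; ring
    rw [e2, add_mul]
    have hNi : (0 : ℝ) < N ^ i := by positivity
    have hρ : 0 < gap N η i / 4 := by linarith
    refine add_le_add ?_ ?_
    · calc 2 ^ i * K * K ^ (n + 2) = A * 2 ^ i := by rw [hA]; ring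
        _ ≤ A * (N ^ i / (gap N η i / 4)) := by
          exact mul_le_mul_of_nonneg_left (h2N.trans h1) hA0
    · rw [abs_of_nonneg (by positivity)]
      push_cast
      calc _ ≤ ((n + 2) * (2 * (N ^ i * K)) + N ^ i) / (gap N η i / 4) * A := by
            gcongr
        _ = _ := by field_simp
  -- Labels times directions, times `2` for the displacement and `2` for the pair of components.
  -- Possible overlaps are merely counted, since `C` may depend on `N`.
  set Z : ℝ := Fintype.card (Label n N) * ((n + 2 : ℕ) * 2 * 2) with hZ
  set C₂ : ℝ := Fintype.card (Label n N) * η ^ (n + 2) with hC₂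
  have hZ0 : 0 ≤ Z := by positivity
  have hC₂0 : 0 ≤ C₂ := by positivity
  refine ⟨Z * A + Z * B + C₂, fun j => ⟨by positivity, by positivity, ?_, ?_, by positivity,
    fun i => ?_, disjoint_generationSupport, fun i => ?_⟩⟩
  · rw [div_lt_one hNpos]; linarith
  · rw [le_div_iff₀ (by positivity)]; linarith
  · have hq : ∀ (q : Label n N) (k : Fin (n + 2)), IsLocalized
        (fun x => displacement N η i q k *
          ((if j = k.succ then 1 else 0) * mainBlock N η i q k x
          + (if j = (partner k).succ then -1 else 0) * sideBlock N η i q k x))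
        (fun l x => displacement N η i q k *
          ((if j = k.succ then 1 else 0) * mainBlockDeriv N η i q k l x
          + (if j = (partner k).succ then -1 else 0) * sideBlockDeriv N η i q k l x))
        (2 * (2 * A)) (2 * (2 * (B * (1 / η) ^ i))) (generationSupport N η i n) := by
      intro q k
      have hBi : 0 ≤ B * (1 / η) ^ i := by positivity
      have hd := abs_displacement_le (i := i) hN0 hη hηN q k
      have b1 := (hblock i q k (mainProfile k) (isProfile_mainProfile k) (hm k) (hm' k)).const_mul
        (if j = k.succ then 1 else 0)
      have b2 := (hblock i q k (sideProfile k) (isProfile_sideProfile k) (hs k) (hs' k)).const_mul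
        (if j = (partner k).succ then -1 else 0)
      have c1 : |(if j = k.succ then (1 : ℝ) else 0)| ≤ 1 := by split_ifs <;> simp
      have c2 : |(if j = (partner k).succ then (-1 : ℝ) else 0)| ≤ 1 := by split_ifs <;> simp
      have b1' := b1.mono (A₁ := A) (L₁ := B * (1 / η) ^ i) (by nlinarith) (by nlinarith) subset_rfl
      have b2' := b2.mono (A₁ := A) (L₁ := B * (1 / η) ^ i) (by nlinarith) (by nlinarith) subset_rfl
      have b3 := IsLocalized.sum (Finset.univ : Finset (Fin 2))
        (F := ![_, _]) (F' := ![_, _]) (A := ![A, A]) (L := ![B * (1 / η) ^ i, B * (1 / η) ^ i])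
        (S := generationSupport N η i n) (by
          intro r _
          fin_cases r
          · exact b1'
          · exact b2')
      simp only [Fin.sum_univ_two, Matrix.cons_val_zero, Matrix.cons_val_one] at b3
      refine (b3.const_mul (displacement N η i q k)).mono ?_ ?_ subset_rfl
      · nlinarith
      · nlinarith
    have hsum := (IsLocalized.sum Finset.univ fun q _ => IsLocalized.sum Finset.univ
      fun k _ => hq q k).const_mul ((2 / N : ℝ) ^ i)
    have hnn : (0 : ℝ) ≤ (2 / N) ^ i := by positivity
    refine hsum.mono ?_ ?_ subset_rfl
    · rw [abs_of_nonneg hnn]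
      simp only [Finset.sum_const, Finset.card_univ, nsmul_eq_mul, Fintype.card_fin]
      calc _ = Z * A * (2 / N) ^ i := by rw [hZ]; ring
        _ ≤ _ := by
          gcongr
          nlinarith [mul_nonneg hZ0 hB0]
    · rw [abs_of_nonneg hnn]
      simp only [Finset.sum_const, Finset.card_univ, nsmul_eq_mul, Fintype.card_fin]
      calc _ = Z * B * ((2 / N) ^ i * (1 / η) ^ i) := by rw [hZ]; ring
        _ = Z * B * (2 / (N * η)) ^ i := by rw [← mul_pow]; congr 2; field_simp
        _ ≤ _ := by
          gcongr
          nlinarith [mul_nonneg hZ0 hA0]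
  · refine (volume_generationSupport_le hN0 hη).trans (ENNReal.ofReal_le_ofReal ?_)
    gcongr
    have : 0 ≤ Z * A + Z * B := by positivity
    linarith

end Field

/-! ### The centres of different balls stay apart -/

section Separation

variable {n N : ℕ} {η : ℝ} {i : ℕ}

lemma centre_sub_centre (q q' : Label n N) (m : Fin (n + 2)) (θ : ℝ) :
    centre N η i q m θ - centre N η i q' m θ
      = (((q.1 m : ℕ) : ℝ) - ((q'.1 m : ℕ) : ℝ)) * (1 / N + θ * (gap N η i - 1 / N))
        + (((q.2 : ℕ) : ℝ) - ((q'.2 : ℕ) : ℝ)) / 2 * (1 / N + θ * (1 - 1 / N)) := by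
  unfold centre displacement
  ring

lemma gap_mul_le (hη : 0 < η) (hηN : η * N ≤ 1 / 8) : gap N η i * N ≤ 1 / 8 :=
  (mul_le_mul_of_nonneg_right (gap_le hη hηN) (Nat.cast_nonneg N)).trans hηN

/-- The centres differ by `E * σ`, where `E` is a nonzero integer and `gap ≤ σ ≤ 1 / N`. Within a
cell this is at least `σ`; from a copy in another cell, `|E| * σ ≤ 1 - 1 / N` leaves a distance of
at least `1 / N ≥ gap`. -/
lemma gap_le_abs_centre_sub_of_digit_ne (hN : 3 ≤ N) (hη : 0 < η) (hηN : η * N ≤ 1 / 8)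
    {q q' : Label n N} (hb : q.2 = q'.2) {m : Fin (n + 2)} (hm : q.1 m ≠ q'.1 m) {θ : ℝ}
    (hθ : θ ∈ Icc (0 : ℝ) 1) (k : ℤ) :
    gap N η i ≤ |centre N η i q m θ - centre N η i q' m θ - k| := by
  have hN' : (3 : ℝ) ≤ N := by exact_mod_cast hN
  have hNpos : (0 : ℝ) < N := by linarith
  have hgN := gap_mul_le (i := i) hη hηN
  have hg0 := gap_pos (i := i) (by omega : 0 < N) hη
  have hg1 : gap N η i ≤ 1 / N := by rw [le_div_iff₀ hNpos]; linarith
  set σ : ℝ := 1 / N + θ * (gap N η i - 1 / N) with hσ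
  have hσ1 : σ ≤ 1 / N := by nlinarith [hθ.1]
  have hσ2 : gap N η i ≤ σ := by nlinarith [hθ.2]
  set E : ℤ := ((q.1 m : ℕ) : ℤ) - ((q'.1 m : ℕ) : ℤ) with hE
  have e : centre N η i q m θ - centre N η i q' m θ = E * σ := by
    rw [centre_sub_centre, hb, hE]; push_cast; ring
  have hE0 : E ≠ 0 := fun h => hm (Fin.ext (by omega))
  have hE1 : (1 : ℝ) ≤ |(E : ℝ)| := by exact_mod_cast Int.one_le_abs hE0
  have hE2 : |(E : ℝ)| ≤ N - 1 := by
    have h1 := (q.1 m).2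
    have h2 := (q'.1 m).2
    have : |E| ≤ (N : ℤ) - 1 := by rw [abs_le]; omega
    exact_mod_cast this
  have hσ0 : 0 < σ := by linarith
  rw [e]
  rcases eq_or_ne k 0 with hk | hk
  · rw [hk, Int.cast_zero, sub_zero, abs_mul, abs_of_pos hσ0]
    nlinarith
  · have hk1 : (1 : ℝ) ≤ |(k : ℝ)| := by exact_mod_cast Int.one_le_abs hk
    have h1 : |(E : ℝ) * σ| ≤ 1 - 1 / N := by
      rw [abs_mul, abs_of_pos hσ0]
      calc |(E : ℝ)| * σ ≤ (N - 1) * (1 / N) :=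
            mul_le_mul hE2 hσ1 hσ0.le (by linarith)
        _ = 1 - 1 / N := by field_simp
    have h2 := abs_sub_abs_le_abs_sub (k : ℝ) (E * σ)
    rw [abs_sub_comm]
    linarith

lemma half_le_abs_int_add {r : ℝ} (hr : r = 1 / 2 ∨ r = -(1 / 2)) (k : ℤ) :
    1 / 2 ≤ |(k : ℝ) + r| := by
  rcases hr with rfl | rfl
  · rcases le_or_gt 0 k with h | h
    · have : (0 : ℝ) ≤ k := by exact_mod_cast h
      rw [abs_of_nonneg (by linarith)]; linarith
    · have : (k : ℝ) ≤ -1 := by exact_mod_cast (by omega : k ≤ -1)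
      rw [abs_of_neg (by linarith)]; linarith
  · rcases le_or_gt 1 k with h | h
    · have : (1 : ℝ) ≤ k := by exact_mod_cast h
      rw [abs_of_nonneg (by linarith)]; linarith
    · have : (k : ℝ) ≤ 0 := by exact_mod_cast (by omega : k ≤ 0)
      rw [abs_of_neg (by linarith)]; linarith

/-- Within one family a differing digit separates the balls at all times. Across families the half
offset does: in the coordinate `0` once it has arrived, where the digits contribute at most `1/8`
against `1/2`, and in the coordinate `1` while it is at rest, where the offset is half of the
spacing `1 / N`. Hence the coordinate `0` moves first, and two spatial coordinates are needed. -/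
lemma exists_gap_le_abs_centre_sub (hN : 3 ≤ N) (hη : 0 < η) (hηN : η * N ≤ 1 / 8)
    {q q' : Label n N} (hq : q ≠ q') {θ : Fin (n + 2) → ℝ} (hθ : ∀ m, θ m ∈ Icc (0 : ℝ) 1)
    (hθ' : θ 0 = 1 ∨ θ 1 = 0) :
    ∃ m, ∀ k : ℤ, gap N η i ≤ |centre N η i q m (θ m) - centre N η i q' m (θ m) - k| := by
  have hN' : (3 : ℝ) ≤ N := by exact_mod_cast hN
  have hNpos : (0 : ℝ) < N := by linarith
  have hgN := gap_mul_le (i := i) hη hηN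
  have hg0 := gap_pos (i := i) (by omega : 0 < N) hη
  by_cases hb : q.2 = q'.2
  · have : ∃ m, q.1 m ≠ q'.1 m := by
      by_contra hcon
      push Not at hcon
      exact hq (Prod.ext (funext hcon) hb)
    obtain ⟨m, hm⟩ := this
    exact ⟨m, gap_le_abs_centre_sub_of_digit_ne hN hη hηN hb hm (hθ m)⟩
  · set r : ℝ := (((q.2 : ℕ) : ℝ) - ((q'.2 : ℕ) : ℝ)) / 2 with hr
    have hr' : r = 1 / 2 ∨ r = -(1 / 2) := by
      have h1 := q.2.2
      have h2 := q'.2.2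
      have h3 : (q.2 : ℕ) ≠ (q'.2 : ℕ) := fun h => hb (Fin.ext h)
      have : (q.2 : ℕ) = 1 ∧ (q'.2 : ℕ) = 0 ∨ (q.2 : ℕ) = 0 ∧ (q'.2 : ℕ) = 1 := by omega
      rcases this with ⟨h4, h5⟩ | ⟨h4, h5⟩
      · left; rw [hr, h4, h5]; norm_num
      · right; rw [hr, h4, h5]; norm_num
    rcases hθ' with h | h
    · refine ⟨0, fun k => ?_⟩
      set E : ℝ := ((q.1 0 : ℕ) : ℝ) - ((q'.1 0 : ℕ) : ℝ) with hE
      have hE2 : |E| ≤ N := by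
        have h1 : ((q.1 0 : ℕ) : ℝ) ≤ N := by exact_mod_cast (q.1 0).2.le
        have h2 : ((q'.1 0 : ℕ) : ℝ) ≤ N := by exact_mod_cast (q'.1 0).2.le
        have h3 : (0 : ℝ) ≤ ((q.1 0 : ℕ) : ℝ) := Nat.cast_nonneg _
        have h4 : (0 : ℝ) ≤ ((q'.1 0 : ℕ) : ℝ) := Nat.cast_nonneg _
        rw [abs_le]; constructor <;> linarith
      have e : centre N η i q 0 (θ 0) - centre N η i q' 0 (θ 0) - k
          = (((-k : ℤ) : ℝ) + r) - (-(E * gap N η i)) := by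
        rw [centre_sub_centre, h, ← hr, ← hE]; push_cast; ring
      have h1 := half_le_abs_int_add hr' (-k)
      have h2 : |-(E * gap N η i)| ≤ 1 / 8 := by
        rw [abs_neg, abs_mul, abs_of_pos hg0]
        calc |E| * gap N η i ≤ N * gap N η i := mul_le_mul_of_nonneg_right hE2 hg0.le
          _ ≤ 1 / 8 := by linarith
      have h3 := abs_sub_abs_le_abs_sub (((-k : ℤ) : ℝ) + r) (-(E * gap N η i))
      rw [e]
      nlinarith
    · refine ⟨1, fun k => ?_⟩
      set E : ℤ := ((q.1 1 : ℕ) : ℤ) - ((q'.1 1 : ℕ) : ℤ) with hE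
      have e : centre N η i q 1 (θ 1) - centre N η i q' 1 (θ 1) - k
          = (((E - k * N : ℤ) : ℝ) + r) / N := by
        rw [centre_sub_centre, h, ← hr, hE]; push_cast; field_simp; ring
      have h1 := half_le_abs_int_add hr' (E - k * N)
      rw [e, abs_div, abs_of_pos hNpos, le_div_iff₀ hNpos]
      linarith

end Separation

/-! ### The explicit trajectories -/

section Path

variable {n N : ℕ} {η : ℝ}

lemma exists_hasSum_digits (hN : 3 ≤ N) (x : ℝ) :
    ∃ D : ℕ → Fin N, HasSum (fun j => ((D j : ℕ) : ℝ) / N ^ (j + 1)) (Int.fract x) := by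
  have : NeZero N := ⟨by omega⟩
  refine ⟨Real.digits (Int.fract x) N, ?_⟩
  simp only [div_eq_mul_inv]
  exact Real.hasSum_ofDigitsTerm_digits (Int.fract x) (b := N) (by omega)
    ⟨Int.fract_nonneg x, Int.fract_lt_one x⟩

/-- The coordinate `m` of the trajectory that follows the balls with the labels `L`, from the point
`x` at time `0`. -/
def path (N : ℕ) (η : ℝ) (L : ℕ → Label n N) (m : Fin (n + 2)) (x s : ℝ) : ℝ :=
  x + ∑' j, rise m (2 ^ j * s) * (displacement N η j (L j) m / N ^ j)

variable {L : ℕ → Label n N}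

lemma abs_displacement_div_le (hN : 3 ≤ N) (hη : 0 < η) (hηN : η * N ≤ 1 / 8) (q : Label n N)
    (m : Fin (n + 2)) (j : ℕ) : |displacement N η j q m / N ^ j| ≤ 2 * (1 / N) ^ j := by
  have hN0 : 0 < N := by omega
  have hp : (0 : ℝ) < (N : ℝ) ^ j := by positivity
  rw [abs_div, abs_of_pos hp, one_div, inv_pow, ← div_eq_mul_inv]
  gcongr
  exact abs_displacement_le hN0 hη hηN q m

lemma summable_path (hN : 3 ≤ N) (hη : 0 < η) (hηN : η * N ≤ 1 / 8) (m : Fin (n + 2)) (s : ℝ) :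
    Summable fun j => rise m (2 ^ j * s) * (displacement N η j (L j) m / N ^ j) := by
  have hN' : (3 : ℝ) ≤ N := by exact_mod_cast hN
  refine Summable.of_norm_bounded (g := fun j => 2 * (1 / (N : ℝ)) ^ j)
    ((summable_geometric_of_lt_one (by positivity) ?_).mul_left 2) fun j => ?_
  · rw [div_lt_one (by linarith)]; linarith
  · rw [Real.norm_eq_abs, abs_mul, abs_of_nonneg (rise_mem m _).1]
    calc _ ≤ 1 * |displacement N η j (L j) m / N ^ j| :=
          mul_le_mul_of_nonneg_right (rise_mem m _).2 (abs_nonneg _)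
      _ ≤ _ := by rw [one_mul]; exact abs_displacement_div_le hN hη hηN _ m j

lemma path_zero (m : Fin (n + 2)) (x : ℝ) : path N η L m x 0 = x := by
  simp [path, rise_of_le m (by norm_num : (0 : ℝ) ≤ 1 / 2)]

/-- The clock factor `2 ^ j` is beaten by the cell size `N ^ (-j)`, so the series may be
differentiated term by term even at `s = 0`, where the generations accumulate. -/
lemma hasDerivAt_path (hN : 3 ≤ N) (hη : 0 < η) (hηN : η * N ≤ 1 / 8) (m : Fin (n + 2))
    (x s : ℝ) :
    HasDerivAt (path N η L m x)
      (∑' j, (2 / N) ^ j * (deriv (rise m) (2 ^ j * s) * displacement N η j (L j) m)) s := by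
  have hN' : (3 : ℝ) ≤ N := by exact_mod_cast hN
  obtain ⟨K, hK⟩ := (isPulse_deriv_rise m).exists_bound
  have hterm : ∀ (j : ℕ) (s : ℝ), HasDerivAt
      (fun s => rise m (2 ^ j * s) * (displacement N η j (L j) m / N ^ j))
      ((2 / N) ^ j * (deriv (rise m) (2 ^ j * s) * displacement N η j (L j) m)) s := by
    intro j s
    have h2 : HasDerivAt (fun s : ℝ => (2 : ℝ) ^ j * s) (2 ^ j) s := by
      simpa using (hasDerivAt_id s).const_mul ((2 : ℝ) ^ j)
    have h3 := (HasDerivAt.comp s (hasDerivAt_rise m (2 ^ j * s)) h2).mul_const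
      (displacement N η j (L j) m / N ^ j)
    refine h3.congr_deriv ?_
    rw [div_pow]; ring
  have hbound : ∀ (j : ℕ) (s : ℝ),
      ‖(2 / N : ℝ) ^ j * (deriv (rise m) (2 ^ j * s) * displacement N η j (L j) m)‖
        ≤ (2 / (N : ℝ)) ^ j * (K * 2) := by
    intro j s
    have h1 := abs_displacement_le (i := j) (by omega : 0 < N) hη hηN (L j) m
    have hK0 := (abs_nonneg _).trans (hK 0)
    rw [Real.norm_eq_abs, abs_mul, abs_mul, abs_of_nonneg (by positivity : (0 : ℝ) ≤ (2 / N) ^ j)]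
    exact mul_le_mul_of_nonneg_left (mul_le_mul (hK _) h1 (abs_nonneg _) hK0) (by positivity)
  have hsum : Summable fun j => (2 / (N : ℝ)) ^ j * (K * 2) :=
    (summable_geometric_of_lt_one (by positivity)
      (by rw [div_lt_one (by linarith)]; linarith)).mul_right _
  exact (hasDerivAt_tsum hsum hterm hbound (summable_path hN hη hηN m 0) s).const_add x

/-- While the `i`-th generation is active, the path is close to the centre of the ball `L i`. -/
lemma exists_path_eq (hN : 3 ≤ N) (hη : 0 < η) (hηN : η * N ≤ 1 / 8) {b : Fin 2}
    (hb : ∀ j, (L j).2 = b) {m : Fin (n + 2)} {x : ℝ}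
    (hx : HasSum (fun j => (((L j).1 m : ℕ) : ℝ) / N ^ (j + 1)) (Int.fract x)) {i : ℕ} {s : ℝ}
    (hs : (2 : ℝ) ^ i * s ∈ Icc (1 / 2 : ℝ) (3 / 4)) :
    ∃ (k : ℤ) (τ : ℝ), 0 ≤ τ ∧ τ < gap N η i / 4 ∧
      N ^ i * path N η L m x s = centre N η i (L i) m (rise m (2 ^ i * s)) + k + τ := by
  have hN' : (3 : ℝ) ≤ N := by exact_mod_cast hN
  have hN0 : (0 : ℝ) < N := by linarith
  have hg0 := gap_pos (i := i) (by omega : 0 < N) hη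
  have hs0 : 0 < s := by
    by_contra h
    push Not at h
    have : (2 : ℝ) ^ i * s ≤ 0 := mul_nonpos_of_nonneg_of_nonpos (by positivity) h
    linarith [hs.1]
  -- The digit `j` together with its displacement so far: not started for `j < i`, moving for `j =
  -- i`, finished for `j > i`.
  set f : ℕ → ℝ := fun j => (((L j).1 m : ℕ) : ℝ) / N ^ (j + 1)
    + rise m (2 ^ j * s) * (displacement N η j (L j) m / N ^ j) with hf
  have hsum := summable_path (L := L) hN hη hηN m s
  have hfs : Summable f := hx.summable.add hsum
  have hpath : path N η L m x s = ⌊x⌋ + ∑' j, f j := by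
    rw [path, hx.summable.tsum_add hsum, hx.tsum_eq, ← add_assoc, Int.floor_add_fract]
  -- the digits before `i` form an integer
  have hlow : ∃ k : ℤ, N ^ i * ∑ j ∈ Finset.range i, f j = k := by
    refine ⟨∑ j ∈ Finset.range i, ((L j).1 m : ℕ) * (N : ℤ) ^ (i - (j + 1)), ?_⟩
    push_cast
    rw [Finset.mul_sum]
    refine Finset.sum_congr rfl fun j hj => ?_
    rw [Finset.mem_range] at hj
    have h1 : rise m (2 ^ j * s) = 0 := by
      refine rise_of_le m ?_
      have h2 : (2 : ℝ) ^ (j + 1) ≤ 2 ^ i := pow_le_pow_right₀ (by norm_num) hj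
      have h3 := mul_le_mul_of_nonneg_right h2 hs0.le
      rw [pow_succ] at h3
      linarith [hs.2]
    have h4 : (N : ℝ) ^ i = N ^ (i - (j + 1)) * N ^ (j + 1) := by
      rw [← pow_add]; congr 1; omega
    simp only [hf, h1, zero_mul, add_zero]
    rw [h4]
    field_simp
  obtain ⟨k, hk⟩ := hlow
  have hmid : N ^ i * f i = (((L i).1 m : ℕ) : ℝ) / N
      + rise m (2 ^ i * s) * displacement N η i (L i) m := by
    simp only [hf, pow_succ]
    field_simp
  -- What is left of the digit `j = r + i + 1` after its contraction, in units of the `i`-th cell: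
  -- `N ^ i * η ^ (j + 1)` times the digit.
  set T : ℕ → ℝ := fun r => gap N η i * (η ^ (r + 1) * (((L (r + (i + 1))).1 m : ℕ) : ℝ)) with hT
  have hhigh : ∀ r, N ^ i * f (r + (i + 1)) = T r
      + ((b : ℕ) : ℝ) / 2 * (1 - 1 / N) / N * (1 / N) ^ r := by
    intro r
    have h1 : rise m (2 ^ (r + (i + 1)) * s) = 1 := by
      refine rise_of_ge m ?_
      have h2 : (2 : ℝ) ^ (i + 1) ≤ 2 ^ (r + (i + 1)) :=
        pow_le_pow_right₀ (by norm_num) (by omega)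
      have h3 := mul_le_mul_of_nonneg_right h2 hs0.le
      rw [pow_succ] at h3
      linarith [hs.1]
    simp only [hf, hT, h1, displacement, hb, gap]
    rw [div_pow, one_pow, mul_pow, mul_pow, show r + (i + 1) + 1 = i + (r + 2) by ring,
      show r + (i + 1) = i + (r + 1) by ring]
    simp only [pow_add]
    field_simp
    ring
  have hη1 : η ≤ 1 / 24 := by nlinarith
  have hTle : ∀ r, T r ≤ gap N η i * (η * N) * η ^ r := by
    intro r
    have h2 : (((L (r + (i + 1))).1 m : ℕ) : ℝ) ≤ N := by
      exact_mod_cast ((L (r + (i + 1))).1 m).2.le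
    calc T r ≤ gap N η i * (η ^ (r + 1) * N) := by simp only [hT]; gcongr
      _ = _ := by ring
  have hT0 : ∀ r, 0 ≤ T r := fun r => by simp only [hT]; positivity
  have hgs : Summable fun r : ℕ => gap N η i * (η * N) * η ^ r :=
    (summable_geometric_of_lt_one hη.le (by linarith)).mul_left _
  have hTs : Summable T := Summable.of_nonneg_of_le hT0 hTle hgs
  have hN1 : 1 / (N : ℝ) < 1 := by rw [div_lt_one hN0]; linarith
  have hbs : Summable fun r : ℕ => ((b : ℕ) : ℝ) / 2 * (1 - 1 / N) / N * (1 / (N : ℝ)) ^ r :=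
    (summable_geometric_of_lt_one (by positivity) hN1).mul_left _
  refine ⟨k + N ^ i * ⌊x⌋, ∑' r, T r, tsum_nonneg hT0, ?_, ?_⟩
  · calc ∑' r, T r ≤ ∑' r : ℕ, gap N η i * (η * N) * η ^ r := hTs.tsum_le_tsum hTle hgs
      _ = gap N η i * (η * N) * (1 - η)⁻¹ := by
        rw [tsum_mul_left, tsum_geometric_of_lt_one hη.le (by linarith)]
      _ ≤ gap N η i * (1 / 8) * (3 / 2) := by
        have h1 : (1 - η)⁻¹ ≤ 3 / 2 := by
          rw [inv_le_comm₀ (by linarith) (by norm_num)]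
          linarith
        exact mul_le_mul (mul_le_mul_of_nonneg_left hηN hg0.le) h1
          (inv_nonneg.2 (by linarith)) (by positivity)
      _ < _ := by linarith
  · have hsplit := hfs.sum_add_tsum_nat_add (i + 1)
    rw [Finset.sum_range_succ] at hsplit
    -- The offsets gained from the finer generations sum to `b / (2 * N)`, exactly the family offset
    -- in the initial centre of generation `i`.
    have htail : N ^ i * ∑' r, f (r + (i + 1)) = ∑' r, T r + ((b : ℕ) : ℝ) / 2 / N := by
      rw [← tsum_mul_left]
      simp only [hhigh]
      rw [hTs.tsum_add hbs, tsum_mul_left (f := fun r : ℕ => (1 / (N : ℝ)) ^ r),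
        tsum_geometric_of_lt_one (by positivity) hN1]
      congr 1
      have h2 : 1 - 1 / (N : ℝ) ≠ 0 := by linarith
      rw [div_mul_eq_mul_div, mul_assoc, mul_inv_cancel₀ h2, mul_one]
    rw [hpath, ← hsplit, mul_add, mul_add, mul_add, hk, hmid, htail, centre, hb]
    push_cast
    ring

end Path

/-! ### The velocity field along the explicit trajectories -/

section Along

variable {n N : ℕ} {η : ℝ}

lemma generation_eq_zero_of_inactive {s : ℝ} (hs : s ∈ Icc (0 : ℝ) 1) {X : Torus (n + 3)}
    (hX : X 0 = (s : UnitAddCircle)) {i : ℕ} (hi : (2 : ℝ) ^ i * s ∉ Icc (1 / 2 : ℝ) (3 / 4))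
    (j : Fin (n + 3)) : generation N η i j X = 0 := by
  have hclock : ∀ k : Fin (n + 2), clock (deriv (rise k)) i (X 0) = 0 := fun k => by
    rw [hX, clock_coe (isPulse_deriv_rise k) hs, deriv_rise_eq_zero k hi]
  simp [generation, mainBlock, sideBlock, block, hclock]

lemma latticeBump_int_add (f : ℝ → ℝ) (ρ : ℝ) (k : ℤ) {τ : ℝ} (h0 : 0 ≤ τ) (h1 : τ < 1 / 2) :
    latticeBump f ρ (((k : ℝ) + τ : ℝ) : UnitAddCircle) = f (τ / ρ) := by
  have : round τ = 0 := round_eq_zero_iff.2 ⟨by linarith, h1⟩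
  rw [latticeBump_coe, round_intCast_add, this]
  congr 2
  simp

/-- The point is within `gap / 4` of the centre of its own ball in every coordinate, where the
profiles give a pure translation. From any other centre some coordinate differs by at least `3 * gap
/ 4`, beyond the reach `gap / 2` of the bumps. One label survives in the sum. -/
lemma generation_path (hN : 3 ≤ N) (hη : 0 < η) (hηN : η * N ≤ 1 / 8) {L : ℕ → Label n N}
    {b : Fin 2} (hb : ∀ j, (L j).2 = b) {x : Fin (n + 2) → ℝ}
    (hx : ∀ m, HasSum (fun j => (((L j).1 m : ℕ) : ℝ) / N ^ (j + 1)) (Int.fract (x m)))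
    {s : ℝ} (hs : s ∈ Icc (0 : ℝ) 1) {X : Torus (n + 3)} (hX : X 0 = (s : UnitAddCircle))
    (hX' : ∀ m, X (Fin.succ m) = (path N η L m (x m) s : UnitAddCircle)) (i : ℕ)
    (k : Fin (n + 2)) :
    generation N η i k.succ X
      = (2 / N) ^ i * (deriv (rise k) (2 ^ i * s) * displacement N η i (L i) k) := by
  by_cases hi : (2 : ℝ) ^ i * s ∈ Icc (1 / 2 : ℝ) (3 / 4)
  swap
  · rw [generation_eq_zero_of_inactive hs hX hi, deriv_rise_eq_zero k hi, zero_mul, mul_zero]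
  have hN' : (3 : ℝ) ≤ N := by exact_mod_cast hN
  have hg0 := gap_pos (i := i) (by omega : 0 < N) hη
  have hgη := gap_le (i := i) hη hηN
  have hη1 : η ≤ 1 / 24 := by nlinarith
  set θ : Fin (n + 2) → ℝ := fun m => rise m (2 ^ i * s) with hθ
  have hclock : ∀ k : Fin (n + 2), clock (deriv (rise k)) i (X 0) = deriv (rise k) (2 ^ i * s) :=
    fun k => by rw [hX, clock_coe (isPulse_deriv_rise k) hs]
  choose κ τ hτ0 hτ1 hτ using fun m => exists_path_eq hN hη hηN hb (hx m) hi
  have hz : ∀ (q : Label n N) (m : Fin (n + 2)),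
      (N ^ i) • X m.succ - ((centreClock N η i q m (X 0) : ℝ) : UnitAddCircle)
        = (((κ m : ℝ) + τ m + (centre N η i (L i) m (θ m) - centre N η i q m (θ m)) : ℝ) :
          UnitAddCircle) := by
    intro q m
    have e1 : centreClock N η i q m (X 0) = centre N η i q m (θ m) := by
      rw [centreClock, hX, clock_coe (isPulse_risePulse m) hs, risePulse_of_le m hi.2]
    rw [e1, hX' m, ← AddCircle.coe_nsmul, ← AddCircle.coe_sub]
    congr 1
    rw [nsmul_eq_mul, Nat.cast_pow, hτ m]
    ring
  have hother : ∀ q : Label n N, q ≠ L i → ∀ (k : Fin (n + 2)) (f : Fin (n + 2) → ℝ → ℝ),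
      (∀ m, IsProfile (f m)) → block (clock (deriv (rise k)) i) (centreClock N η i q) f
        (gap N η i / 4) (N ^ i) X = 0 := by
    intro q hq k f hf
    have hstage : θ 0 = 1 ∨ θ 1 = 0 := by
      rcases le_total (5 / 8) ((2 : ℝ) ^ i * s) with h | h
      · exact Or.inl (rise_zero_of_ge h)
      · exact Or.inr (rise_of_ne_zero_of_le one_ne_zero h)
    obtain ⟨m, hm⟩ := exists_gap_le_abs_centre_sub (i := i) hN hη hηN hq.symm
      (fun m => rise_mem m _) hstage
    rw [block, Finset.prod_eq_zero (Finset.mem_univ m), mul_zero]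
    refine latticeBump_eq_zero (hf m) (by linarith) ?_
    rw [hz q m, UnitAddCircle.norm_eq]
    set w : ℝ := (κ m : ℝ) + τ m + (centre N η i (L i) m (θ m) - centre N η i q m (θ m)) with hw
    have h1 := hm (round w - κ m)
    have h2 : centre N η i (L i) m (θ m) - centre N η i q m (θ m) - ((round w - κ m : ℤ) : ℝ)
        = (w - round w) - τ m := by rw [hw]; push_cast; ring
    rw [h2] at h1
    have h3 := abs_sub (w - round w) (τ m)
    rw [abs_of_nonneg (hτ0 m)] at h3
    linarith [hτ1 m]
  have hself : ∀ (f : ℝ → ℝ) (m : Fin (n + 2)), latticeBump f (gap N η i / 4)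
      ((N ^ i) • X m.succ - ((centreClock N η i (L i) m (X 0) : ℝ) : UnitAddCircle))
        = f (τ m / (gap N η i / 4)) := by
    intro f m
    rw [hz, sub_self, add_zero]
    exact latticeBump_int_add f _ (κ m) (hτ0 m) (by linarith [hτ1 m])
  have hτabs : ∀ m, |τ m / (gap N η i / 4)| < 1 := by
    intro m
    have h4 : 0 < gap N η i / 4 := by linarith
    rw [abs_of_nonneg (div_nonneg (hτ0 m) h4.le), div_lt_one h4]
    exact hτ1 m
  have hmain : ∀ k : Fin (n + 2), mainBlock N η i (L i) k X = deriv (rise k) (2 ^ i * s) := by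
    intro k
    rw [mainBlock, block, hclock, Finset.prod_eq_one, mul_one]
    intro m _
    rw [hself, mainProfile_eq_one k m (hτabs m)]
  have hside : ∀ k : Fin (n + 2), sideBlock N η i (L i) k X = 0 := by
    intro k
    rw [sideBlock, block, Finset.prod_eq_zero (Finset.mem_univ k), mul_zero]
    rw [hself, sideProfile_self_eq_zero k (hτabs k)]
  rw [generation, Finset.sum_eq_single (L i)]
  · congr 1
    simp only [hmain, hside, mul_zero, add_zero, Fin.succ_inj]
    rw [Finset.sum_eq_single k]
    · simp [mul_comm]
    · intro k' _ hk'
      simp [hk'.symm]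
    · simp
  · intro q _ hq
    refine Finset.sum_eq_zero fun k' _ => ?_
    rw [mainBlock, sideBlock, hother q hq k' _ (isProfile_mainProfile k'),
      hother q hq k' _ (isProfile_sideProfile k')]
    simp
  · simp

end Along

/-! ### Solutions in the universal cover -/

section Solutions

variable {d : ℕ}

/-- `Γ` solves the lifted differential equation on `[0, T]`. -/
def SolvesOn (u : Torus d → Space d) (T : ℝ) (Γ : ℝ → Space d) : Prop :=
  ∀ t ∈ Icc 0 T, HasDerivWithinAt Γ (u (toTorus (Γ t))) (Icc 0 T) t

lemma hasDerivWithinAt_space {Γ : ℝ → Space d} {v : Space d} {S : Set ℝ} {t : ℝ}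
    (h : ∀ j, HasDerivWithinAt (fun s => Γ s j) (v j) S t) : HasDerivWithinAt Γ v S t := by
  have h1 : HasDerivWithinAt (fun s => (fun j => Γ s j)) (fun j => v j) S t :=
    hasDerivWithinAt_pi.2 h
  exact ((EuclideanSpace.equiv (Fin d) ℝ).symm : (Fin d → ℝ) →L[ℝ] Space d).hasFDerivAt
    |>.comp_hasDerivWithinAt t h1

lemma HasDerivWithinAt.apply_space {Γ : ℝ → Space d} {v : Space d} {S : Set ℝ} {t : ℝ}
    (h : HasDerivWithinAt Γ v S t) (j : Fin d) : HasDerivWithinAt (fun s => Γ s j) (v j) S t :=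
  (EuclideanSpace.proj j : Space d →L[ℝ] ℝ).hasFDerivAt.comp_hasDerivWithinAt t h

variable {u : Torus d → Space d}

lemma SolvesOn.mono {T T' : ℝ} {Γ : ℝ → Space d} (h : SolvesOn u T Γ) (hT : T' ≤ T) :
    SolvesOn u T' Γ :=
  fun t ht => (h t ⟨ht.1, ht.2.trans hT⟩).mono (Icc_subset_Icc_right hT)

lemma SolvesOn.isTrajectory {T K : ℝ} {Γ : ℝ → Space d} (h : SolvesOn u T Γ) (hT : 0 ≤ T)
    (hu : ∀ x, ‖u x‖ ≤ K) : IsTrajectory u T (toTorus (Γ 0)) (fun t => toTorus (Γ t)) := by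
  refine ⟨?_, fun t ht => ⟨Γ, fun _ _ => rfl, h t ht⟩, rfl⟩
  have hK : 0 ≤ K := (norm_nonneg _).trans (hu 0)
  have h1 : LipschitzOnWith K.toNNReal Γ (Icc 0 T) :=
    (convex_Icc 0 T).lipschitzOnWith_of_nnnorm_hasDerivWithin_le h fun t _ => by
      rw [← NNReal.coe_le_coe, coe_nnnorm, Real.coe_toNNReal K hK]
      exact hu _
  refine LipschitzOnWith.absolutelyContinuousOnInterval (K := 1 * K.toNNReal) ?_
  rw [uIcc_of_le hT]
  exact lipschitzWith_toTorus.comp_lipschitzOnWith h1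

/-- At the junction both one-sided derivatives equal the value of the field at the common point, so
they combine. -/
lemma SolvesOn.exists_glue {T₁ T₂ : ℝ} {Γ₁ Γ₂ : ℝ → Space d} (h₁ : SolvesOn u T₁ Γ₁)
    (h₂ : SolvesOn u T₂ Γ₂) (hT₁ : 0 ≤ T₁) (h : Γ₂ 0 = Γ₁ T₁) :
    ∃ Γ, SolvesOn u (T₁ + T₂) Γ ∧ (∀ t ∈ Icc 0 T₁, Γ t = Γ₁ t) ∧
      ∀ t ∈ Icc 0 T₂, Γ (T₁ + t) = Γ₂ t := by
  set Γ : ℝ → Space d := fun t => if t ≤ T₁ then Γ₁ t else Γ₂ (t - T₁) with hΓ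
  have e₁ : ∀ t ∈ Icc 0 T₁, Γ t = Γ₁ t := fun t ht => by simp [hΓ, ht.2]
  have e₂ : ∀ t ∈ Icc T₁ (T₁ + T₂), Γ t = Γ₂ (t - T₁) := by
    intro t ht
    rcases eq_or_lt_of_le ht.1 with h' | h'
    · subst h'; simp [hΓ, h]
    · simp [hΓ, h'.not_ge]
  have d₁ : ∀ t ∈ Icc 0 T₁, HasDerivWithinAt Γ (u (toTorus (Γ t))) (Icc 0 T₁) t := by
    intro t ht
    rw [e₁ t ht]
    exact (h₁ t ht).congr e₁ (e₁ t ht)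
  have d₂ : ∀ t ∈ Icc T₁ (T₁ + T₂),
      HasDerivWithinAt Γ (u (toTorus (Γ t))) (Icc T₁ (T₁ + T₂)) t := by
    intro t ht
    rw [e₂ t ht]
    refine HasDerivWithinAt.congr ?_ e₂ (e₂ t ht)
    have hm : MapsTo (fun r => r - T₁) (Icc T₁ (T₁ + T₂)) (Icc 0 T₂) :=
      fun r hr => ⟨sub_nonneg.2 hr.1, by linarith [hr.2]⟩
    have h3 := HasDerivWithinAt.scomp t (h₂ (t - T₁) (hm ht))
      ((hasDerivAt_id t).sub_const T₁).hasDerivWithinAt hm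
    rw [one_smul] at h3
    exact h3
  refine ⟨Γ, fun t ht => ?_, e₁, fun t ht => ?_⟩
  · rcases lt_trichotomy t T₁ with h' | h' | h'
    · refine (d₁ t ⟨ht.1, h'.le⟩).mono_of_mem_nhdsWithin ?_
      filter_upwards [self_mem_nhdsWithin, mem_nhdsWithin_of_mem_nhds (Iic_mem_nhds h')]
        with r hr hr' using ⟨hr.1, hr'⟩
    · subst h'
      rw [← Icc_union_Icc_eq_Icc ht.1 ht.2]
      exact (d₁ t ⟨ht.1, le_rfl⟩).union (d₂ t ⟨le_rfl, ht.2⟩)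
    · refine (d₂ t ⟨h'.le, ht.2⟩).mono_of_mem_nhdsWithin ?_
      filter_upwards [self_mem_nhdsWithin, mem_nhdsWithin_of_mem_nhds (Ici_mem_nhds h')]
        with r hr hr' using ⟨hr', hr.2⟩
  · rw [e₂ (T₁ + t) ⟨by linarith [ht.1], by linarith [ht.2]⟩]
    simp

lemma norm_le_sum_abs (v : Space d) : ‖v‖ ≤ ∑ j, |v j| := by
  have e : v = ∑ j, EuclideanSpace.single j (v j) := by
    ext i
    simp
  conv_lhs => rw [e]
  refine (norm_sum_le _ _).trans (le_of_eq ?_)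
  simp

/-- A bounded Lipschitz field on the torus has solutions on every interval. -/
lemma exists_solvesOn_of_lipschitz {A K T : ℝ} (hA : ∀ j x, |u x j| ≤ A)
    (hK : ∀ j x y, |u x j - u y j| ≤ K * dist x y) (hK0 : 0 ≤ K) (hT : 0 ≤ T) (X₀ : Space d) :
    ∃ Γ, Γ 0 = X₀ ∧ SolvesOn u T Γ := by
  set B : ℝ≥0 := (d * |A|).toNNReal with hB
  have hBv : (B : ℝ) = d * |A| := Real.coe_toNNReal _ (by positivity)
  set K' : ℝ≥0 := (d * K).toNNReal with hK'
  have hKv : (K' : ℝ) = d * K := Real.coe_toNNReal _ (by positivity)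
  have hlip : LipschitzWith K' fun X : Space d => u (toTorus X) := by
    refine LipschitzWith.of_dist_le_mul fun X Y => ?_
    rw [dist_eq_norm, hKv]
    refine (norm_le_sum_abs _).trans ?_
    calc ∑ j, |(u (toTorus X) - u (toTorus Y)) j| ≤ ∑ _j : Fin d, K * dist X Y := by
          refine Finset.sum_le_sum fun j _ => (hK j _ _).trans ?_
          have := lipschitzWith_toTorus.dist_le_mul X Y
          rw [NNReal.coe_one, one_mul] at this
          gcongr
      _ = _ := by simp; ring
  -- A ball of radius `B * T` cannot be left within the time `T` at speed at most `B`.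
  have hpl : IsPicardLindelof (fun (_ : ℝ) (X : Space d) => u (toTorus X))
      (⟨0, le_rfl, hT⟩ : Icc (0 : ℝ) T) X₀ (B * T.toNNReal) 0 B K' := by
    refine ⟨fun _ _ => hlip.lipschitzOnWith, fun _ _ => continuousOn_const, fun _ _ X _ => ?_, ?_⟩
    · rw [hBv]
      refine (norm_le_sum_abs _).trans ?_
      calc ∑ j, |u (toTorus X) j| ≤ ∑ _j : Fin d, |A| :=
            Finset.sum_le_sum fun j _ => (hA j _).trans (le_abs_self A)
        _ = _ := by simp
    · simp [hT]
  obtain ⟨Γ, h0, h1⟩ := hpl.exists_eq_forall_mem_Icc_hasDerivWithinAt₀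
  exact ⟨Γ, h0, h1⟩

end Solutions

/-! ### The steady field -/

section SteadyField

variable {n N : ℕ} {η lam : ℝ}

/-- The steady field: the coordinate `x 0` plays the role of time, and the balls of all generations
move in the other coordinates. -/
def steadyField (n N : ℕ) (η lam : ℝ) (x : Torus (n + 3)) : Space (n + 3) :=
  WithLp.toLp 2 fun j => lam * ((if j = 0 then 1 else 0) + ∑' i, generation N η i j x)

lemma steadyField_apply (x : Torus (n + 3)) (j : Fin (n + 3)) :
    steadyField n N η lam x j
      = lam * ((if j = 0 then 1 else 0) + ∑' i, generation N η i j x) := rfl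

/-- The part of the steady field of the generations before `K`. -/
def truncatedField (n N : ℕ) (η lam : ℝ) (K : ℕ) (x : Torus (n + 3)) : Space (n + 3) :=
  WithLp.toLp 2 fun j => lam * ((if j = 0 then 1 else 0)
    + ∑ i ∈ Finset.range K, generation N η i j x)

lemma truncatedField_apply (K : ℕ) (x : Torus (n + 3)) (j : Fin (n + 3)) :
    truncatedField n N η lam K x j
      = lam * ((if j = 0 then 1 else 0) + ∑ i ∈ Finset.range K, generation N η i j x) := rfl

lemma coe_int_circle (k : ℤ) : (((k : ℤ) : ℝ) : UnitAddCircle) = 0 := by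
  rw [AddCircle.coe_eq_zero_iff]; exact ⟨k, by simp⟩

/-- From a point with integral time coordinate, two solutions start, one for each family of balls,
that are different after one period. -/
lemma exists_two_solutions (hN : 3 ≤ N) (hη : 0 < η) (hηN : η * N ≤ 1 / 8) (hlam : 0 < lam)
    {X₀ : Space (n + 3)} {k : ℤ} (hX₀ : X₀ 0 = k) :
    ∃ Γ : Fin 2 → ℝ → Space (n + 3), (∀ b, Γ b 0 = X₀) ∧
      (∀ b, SolvesOn (steadyField n N η lam) (1 / lam) (Γ b)) ∧
      (∀ b, Γ b (1 / lam) 0 = ((k + 1 : ℤ) : ℝ)) ∧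
      Γ 1 (1 / lam) 1 - Γ 0 (1 / lam) 1 = 1 / 2 := by
  have hN' : (3 : ℝ) ≤ N := by exact_mod_cast hN
  have hN0 : (0 : ℝ) < N := by linarith
  choose D hD using fun m : Fin (n + 2) => exists_hasSum_digits hN (X₀ m.succ)
  -- Both solutions use the digits of the starting point and differ in the family only.
  set L : Fin 2 → ℕ → Label n N := fun b j => (fun m => D m j, b) with hL
  set Γ : Fin 2 → ℝ → Space (n + 3) := fun b t => WithLp.toLp 2
    (Fin.cons (X₀ 0 + lam * t) fun m => path N η (L b) m (X₀ m.succ) (lam * t)) with hΓ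
  have Γ0 : ∀ b t, Γ b t 0 = X₀ 0 + lam * t := fun b t => rfl
  have Γs : ∀ b t m, Γ b t (Fin.succ m) = path N η (L b) m (X₀ m.succ) (lam * t) :=
    fun b t m => rfl
  refine ⟨Γ, fun b => ?_, fun b t ht => ?_, fun b => ?_, ?_⟩
  · ext j
    refine Fin.cases ?_ (fun m => ?_) j
    · rw [Γ0]; simp
    · rw [Γs, mul_zero, path_zero]
  · have hs : lam * t ∈ Icc (0 : ℝ) 1 := by
      refine ⟨mul_nonneg hlam.le ht.1, ?_⟩
      calc lam * t ≤ lam * (1 / lam) := mul_le_mul_of_nonneg_left ht.2 hlam.le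
        _ = 1 := by field_simp
    have hX : toTorus (Γ b t) 0 = ((lam * t : ℝ) : UnitAddCircle) := by
      change ((Γ b t 0 : ℝ) : UnitAddCircle) = _
      rw [Γ0, hX₀, AddCircle.coe_add, coe_int_circle, zero_add]
    have hX' : ∀ m, toTorus (Γ b t) (Fin.succ m)
        = (path N η (L b) m (X₀ m.succ) (lam * t) : UnitAddCircle) := fun m => rfl
    refine hasDerivWithinAt_space fun j => HasDerivAt.hasDerivWithinAt ?_
    have hl : HasDerivAt (fun t : ℝ => lam * t) lam t := by
      simpa using (hasDerivAt_id t).const_mul lam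
    refine Fin.cases ?_ (fun m => ?_) j
    · rw [steadyField_apply]
      simp only [generation_zero, tsum_zero, if_true, add_zero, mul_one, Γ0]
      exact hl.const_add _
    · rw [steadyField_apply]
      simp only [Fin.succ_ne_zero, if_false, zero_add, Γs]
      have h1 := HasDerivAt.comp t
        (hasDerivAt_path (L := L b) hN hη hηN m (X₀ m.succ) (lam * t)) hl
      rw [mul_comm] at h1
      simp only [generation_path (L := L b) (b := b) (x := fun m => X₀ m.succ) hN hη hηN
        (fun _ => rfl) hD hs hX hX']
      exact h1
  · rw [Γ0, hX₀]
    push_cast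
    field_simp
  · change Γ 1 (1 / lam) (Fin.succ 0) - Γ 0 (1 / lam) (Fin.succ 0) = 1 / 2
    have hr : ∀ j : ℕ, rise (0 : Fin (n + 2)) (2 ^ j * (lam * (1 / lam))) = 1 := by
      intro j
      have : (1 : ℝ) ≤ 2 ^ j := one_le_pow₀ (by norm_num)
      rw [mul_one_div_cancel hlam.ne', mul_one]
      exact rise_of_ge 0 (by linarith)
    have s1 := summable_path (L := L 1) hN hη hηN 0 (lam * (1 / lam))
    have s0 := summable_path (L := L 0) hN hη hηN 0 (lam * (1 / lam))
    rw [Γs, Γs, path, path, add_sub_add_left_eq_sub, ← s1.tsum_sub s0]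
    -- After a full period every generation has finished; the digit parts cancel and the family
    -- offsets form a geometric series with sum `1/2`.
    have hterm : ∀ j : ℕ, rise (0 : Fin (n + 2)) (2 ^ j * (lam * (1 / lam)))
          * (displacement N η j (L 1 j) 0 / N ^ j)
        - rise (0 : Fin (n + 2)) (2 ^ j * (lam * (1 / lam)))
          * (displacement N η j (L 0 j) 0 / N ^ j) = 1 / 2 * (1 - 1 / N) * (1 / N) ^ j := by
      intro j
      rw [hr j, displacement, displacement, div_pow, one_pow]
      simp only [hL, Fin.val_one, Fin.val_zero, Nat.cast_one, Nat.cast_zero]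
      ring
    have hN1 : 1 / (N : ℝ) < 1 := by rw [div_lt_one hN0]; linarith
    simp only [hterm]
    rw [tsum_mul_left, tsum_geometric_of_lt_one (by positivity) hN1, mul_assoc,
      mul_inv_cancel₀ (by linarith), mul_one]

/-- From a point with integral time coordinate, solutions exist for any number of periods. -/
lemma exists_solution_periods (hN : 3 ≤ N) (hη : 0 < η) (hηN : η * N ≤ 1 / 8) (hlam : 0 < lam)
    (P : ℕ) {X₀ : Space (n + 3)} {k : ℤ} (hX₀ : X₀ 0 = k) :
    ∃ Γ, Γ 0 = X₀ ∧ SolvesOn (steadyField n N η lam) (P * (1 / lam)) Γ := by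
  induction P generalizing X₀ k with
  | zero =>
    refine ⟨fun _ => X₀, rfl, fun t ht => ?_⟩
    have : Icc (0 : ℝ) ((0 : ℕ) * (1 / lam)) = {0} := by simp
    rw [this] at ht ⊢
    rw [mem_singleton_iff.1 ht]
    exact HasFDerivWithinAt.of_subsingleton subsingleton_singleton
  | succ P ih =>
    obtain ⟨Γ, h0, hs, h1, -⟩ := exists_two_solutions hN hη hηN hlam hX₀
    obtain ⟨Γ', h0', hs'⟩ := ih (h1 0)
    have hpos : 0 ≤ 1 / lam := by positivity
    obtain ⟨Γ'', h2, h3, -⟩ := (hs 0).exists_glue hs' hpos h0'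
    refine ⟨Γ'', by rw [h3 0 ⟨le_rfl, hpos⟩, h0], ?_⟩
    have : ((P + 1 : ℕ) : ℝ) * (1 / lam) = 1 / lam + P * (1 / lam) := by push_cast; ring
    rw [this]
    exact h2

/-- From every point, a solution leads to a point with integral time coordinate. -/
lemma exists_solution_to_integer (hN : 3 ≤ N) (hη : 0 < η) (hηN : η * N ≤ 1 / 8) (hlam : 0 < lam)
    (X₀ : Space (n + 3)) :
    ∃ T Γ, 0 ≤ T ∧ T ≤ 1 / lam ∧ Γ 0 = X₀ ∧ SolvesOn (steadyField n N η lam) T Γ ∧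
      ∃ k : ℤ, Γ T 0 = k := by
  set s₀ : ℝ := Int.fract (X₀ 0) with hs₀
  have hs0 : 0 ≤ s₀ := Int.fract_nonneg _
  have hs1 : s₀ < 1 := Int.fract_lt_one _
  have hfl : X₀ 0 = ⌊X₀ 0⌋ + s₀ := (Int.floor_add_fract _).symm
  rcases eq_or_lt_of_le hs0 with h | h
  · obtain ⟨Γ, h0, h1⟩ := exists_solution_periods hN hη hηN hlam 0
      (show X₀ 0 = (⌊X₀ 0⌋ : ℝ) by linarith)
    refine ⟨0, Γ, le_rfl, by positivity, h0, by simpa using h1, ⌊X₀ 0⌋, ?_⟩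
    rw [h0]; linarith
  -- As `2 ^ K * s₀ > 1`, the generations from `K` on are over at the time `s₀`. Up to the next
  -- integral time the steady field equals its truncation, which is Lipschitz.
  obtain ⟨K, hK⟩ := pow_unbounded_of_one_lt (1 / s₀) (one_lt_two : (1 : ℝ) < 2)
  obtain ⟨C, hC⟩ := exists_isGeometric_generation n hN hη hηN
  set T : ℝ := (1 - s₀) / lam with hT
  have hT0 : 0 ≤ T := div_nonneg (by linarith) hlam.le
  have hl := fun j => IsLocalized.sum (Finset.range K) (S := univ)
    fun i _ => ((hC j).localized i).mono le_rfl le_rfl (subset_univ _)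
  set A : ℝ := ∑ i ∈ Finset.range K, C * (2 / N) ^ i with hA
  set B : ℝ := ∑ i ∈ Finset.range K, C * (2 / (N * η)) ^ i with hB
  have hB0 : 0 ≤ B := (abs_nonneg _).trans ((hl 0).bound_deriv 0 0)
  obtain ⟨Γ, h0, h1⟩ := exists_solvesOn_of_lipschitz (u := truncatedField n N η lam K)
    (A := lam * (1 + A)) (K := lam * ((n + 3 : ℕ) * B)) (T := T) (fun j x => by
      rw [truncatedField_apply, abs_mul, abs_of_pos hlam]
      refine mul_le_mul_of_nonneg_left ((abs_add_le _ _).trans (add_le_add ?_ ((hl j).bound x)))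
        hlam.le
      split_ifs <;> simp)
    (fun j x y => by
      rw [truncatedField_apply, truncatedField_apply, ← mul_sub, add_sub_add_left_eq_sub, abs_mul,
        abs_of_pos hlam, mul_assoc]
      exact mul_le_mul_of_nonneg_left ((hl j).abs_sub_le x y) hlam.le)
    (by positivity) hT0 X₀
  have htime : ∀ t ∈ Icc 0 T, Γ t 0 = X₀ 0 + lam * t := by
    intro t ht
    have hd : ∀ r ∈ Icc 0 T, HasDerivWithinAt (fun r => Γ r 0 - lam * r) 0 (Icc 0 T) r := by
      intro r hr
      have h2 := (HasDerivWithinAt.apply_space (h1 r hr) 0).sub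
        ((hasDerivAt_id r).const_mul lam).hasDerivWithinAt
      refine h2.congr_deriv ?_
      simp [truncatedField_apply, generation_zero]
    have h3 := (convex_Icc 0 T).norm_image_sub_le_of_norm_hasDerivWithin_le (C := 0) hd
      (fun r _ => by simp) (⟨le_rfl, hT0⟩ : (0 : ℝ) ∈ Icc 0 T) ht
    rw [zero_mul, norm_le_zero_iff, h0] at h3
    linarith
  have hTlam : lam * T = 1 - s₀ := by rw [hT]; field_simp
  refine ⟨T, Γ, hT0, ?_, h0, fun t ht => ?_, ⌊X₀ 0⌋ + 1, ?_⟩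
  · rw [hT]; gcongr; linarith
  · have hfield : steadyField n N η lam (toTorus (Γ t))
        = truncatedField n N η lam K (toTorus (Γ t)) := by
      ext j
      rw [steadyField_apply, truncatedField_apply]
      congr 2
      refine tsum_eq_sum fun i hi => ?_
      rw [Finset.mem_range, not_lt] at hi
      have hlt : lam * t ≤ 1 - s₀ := by
        rw [← hTlam]; exact mul_le_mul_of_nonneg_left ht.2 hlam.le
      have hlt0 : 0 ≤ lam * t := mul_nonneg hlam.le ht.1
      refine generation_eq_zero_of_inactive (s := s₀ + lam * t) ⟨by linarith, by linarith⟩ ?_ ?_ j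
      · change ((Γ t 0 : ℝ) : UnitAddCircle) = _
        rw [htime t ht, hfl, add_assoc, AddCircle.coe_add, coe_int_circle, zero_add]
      · intro hmem
        have h4 : (2 : ℝ) ^ K ≤ 2 ^ i := pow_le_pow_right₀ (by norm_num) hi
        have h5 : 1 < (2 : ℝ) ^ K * s₀ := by rwa [div_lt_iff₀ h] at hK
        have h6 : (2 : ℝ) ^ K * s₀ ≤ 2 ^ i * (s₀ + lam * t) :=
          mul_le_mul h4 (by linarith) hs0 (by positivity)
        linarith [hmem.2]
    rw [hfield]
    exact h1 t ht
  · rw [htime T ⟨hT0, le_rfl⟩, hTlam, hfl]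
    simp only [Int.floor_intCast_add, Int.floor_fract, hs₀]
    push_cast
    ring

lemma continuous_steadyField (hN : 3 ≤ N) (hη : 0 < η) (hηN : η * N ≤ 1 / 8) :
    Continuous (steadyField n N η lam) := by
  obtain ⟨C, hC⟩ := exists_isGeometric_generation n hN hη hηN
  refine (PiLp.continuous_toLp 2 _).comp (continuous_pi fun j => ?_)
  exact ((hC j).continuous_tsum.const_add _).const_mul _

lemma exists_bound_steadyField (hN : 3 ≤ N) (hη : 0 < η) (hηN : η * N ≤ 1 / 8) :
    ∃ K, ∀ x, ‖steadyField n N η lam x‖ ≤ K := by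
  obtain ⟨K, hK⟩ := (isCompact_range (continuous_steadyField (n := n) (lam := lam) hN hη
    hηN)).isBounded.exists_norm_le
  exact ⟨K, fun x => hK _ ⟨x, rfl⟩⟩

/-- The trajectories from every point are not unique on an interval that contains two periods. -/
lemma mem_nonuniquenessSet_steadyField (hN : 3 ≤ N) (hη : 0 < η) (hηN : η * N ≤ 1 / 8)
    (hlam : 0 < lam) {T : ℝ} (hT : 2 / lam ≤ T) (x : Torus (n + 3)) :
    x ∈ nonuniquenessSet (steadyField n N η lam) T := by
  obtain ⟨X₀, rfl⟩ := isOpenQuotientMap_toTorus.surjective x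
  obtain ⟨K, hK⟩ := exists_bound_steadyField (n := n) (lam := lam) hN hη hηN
  obtain ⟨T₁, Γ₁, hT₁, hT₁', h0, hs, k, hk⟩ := exists_solution_to_integer hN hη hηN hlam X₀
  obtain ⟨Γ₂, h0₂, hs₂, hend, hdiff⟩ := exists_two_solutions hN hη hηN hlam hk
  -- Enough periods after the splitting to exceed `T`; the glued solutions are then restricted to
  -- `[0, T]`.
  obtain ⟨P, hP⟩ := exists_nat_ge (T * lam)
  have hpos : 0 < 1 / lam := by positivity
  have hT0 : 0 ≤ T := le_trans (by positivity) hT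
  have hlong : T ≤ T₁ + 1 / lam + P * (1 / lam) := by
    have : T ≤ P * (1 / lam) := by rw [mul_one_div, le_div_iff₀ hlam]; exact hP
    linarith
  have hfull : ∀ b : Fin 2, ∃ Γ, Γ 0 = X₀ ∧ SolvesOn (steadyField n N η lam) T Γ ∧
      Γ (T₁ + 1 / lam) = Γ₂ b (1 / lam) := by
    intro b
    obtain ⟨Γ₃, h0₃, hs₃⟩ := exists_solution_periods hN hη hηN hlam P (hend b)
    obtain ⟨Δ, hΔ, hΔ₁, hΔ₂⟩ := hs.exists_glue (hs₂ b) hT₁ (h0₂ b)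
    have e := hΔ₂ (1 / lam) ⟨hpos.le, le_rfl⟩
    obtain ⟨Γ, hΓ, hΓ₁, -⟩ := hΔ.exists_glue hs₃ (by linarith) (h0₃.trans e.symm)
    refine ⟨Γ, ?_, hΓ.mono hlong, ?_⟩
    · rw [hΓ₁ 0 ⟨le_rfl, by linarith⟩, hΔ₁ 0 ⟨le_rfl, hT₁⟩, h0]
    · rw [hΓ₁ _ ⟨by linarith, le_rfl⟩, e]
  obtain ⟨Γ, hΓ0, hΓs, hΓe⟩ := hfull 0
  obtain ⟨Γ', hΓ0', hΓs', hΓe'⟩ := hfull 1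
  have t1 := hΓs.isTrajectory hT0 hK
  have t2 := hΓs'.isTrajectory hT0 hK
  rw [hΓ0] at t1
  rw [hΓ0'] at t2
  refine ⟨_, _, t1, t2, T₁ + 1 / lam, ⟨by linarith, ?_⟩, fun heq => ?_⟩
  · have : 2 / lam = 1 / lam + 1 / lam := by ring
    linarith
  · have h1 := congrFun heq 1
    simp only [hΓe, hΓe', toTorus] at h1
    have h2 : ((1 / 2 : ℝ) : UnitAddCircle) = 0 := by
      rw [← hdiff, AddCircle.coe_sub, h1, sub_self]
    rw [AddCircle.coe_eq_zero_iff] at h2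
    obtain ⟨z, hz⟩ := h2
    have h3 : (2 * z : ℝ) = 1 := by
      have : (z : ℝ) = 1 / 2 := by simpa using hz
      linarith
    have h4 : (2 * z : ℤ) = 1 := by exact_mod_cast h3
    omega

end SteadyField

/-! ### Regularity of the steady field, and the choice of the parameters -/

lemma HasWeakPartialDeriv.const_mul_const_add {d : ℕ} {j : Fin d} {f g : Torus d → ℝ}
    (h : HasWeakPartialDeriv j f g) (lam c : ℝ) :
    HasWeakPartialDeriv j (fun x => lam * (c + f x)) (fun x => lam * g x) := by
  refine ⟨((integrable_const c).add h.1).const_mul lam, h.2.1.const_mul lam, fun φ hφ => ?_⟩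
  have hc := hφ.continuous_partialDeriv j
  obtain ⟨K, hK⟩ := (isCompact_range hc).isBounded.exists_norm_le
  have h0 : ∫ x, partialDeriv j φ x = 0 := (hφ.hasPartial j).integral_eq_zero hφ.continuous hc
  have i1 : Integrable fun x => f x * partialDeriv j φ x :=
    h.1.mul_bdd (c := K) hc.aestronglyMeasurable
      (Filter.Eventually.of_forall fun x => hK _ ⟨x, rfl⟩)
  calc ∫ x, lam * (c + f x) * partialDeriv j φ x
      = ∫ x, lam * (c * partialDeriv j φ x + f x * partialDeriv j φ x) := by
        congr 1; ext x; ring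
    _ = lam * (c * (∫ x, partialDeriv j φ x) + ∫ x, f x * partialDeriv j φ x) := by
        rw [integral_const_mul, integral_add ((integrable_of_continuous hc).const_mul c) i1,
          integral_const_mul]
    _ = -∫ x, lam * g x * φ x := by
        rw [h0, mul_zero, zero_add, h.2.2 φ hφ]
        simp only [mul_assoc]
        rw [integral_const_mul]
        ring

/-- A field whose weak derivatives exist and have vanishing trace is divergence-free. -/
lemma isDivergenceFree_of_hasWeakPartialDeriv {d : ℕ} {u : Torus d → Space d}
    {g : Fin d → Torus d → ℝ} (h : ∀ j, HasWeakPartialDeriv j (fun x => u x j) (g j))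
    (hg : ∀ x, ∑ j, g j x = 0) : IsDivergenceFree u := by
  intro φ hφ
  obtain ⟨K, hK⟩ := (isCompact_range hφ.continuous).isBounded.exists_norm_le
  have i1 : ∀ j, Integrable fun x => u x j * partialDeriv j φ x := by
    intro j
    have hc := hφ.continuous_partialDeriv j
    obtain ⟨K', hK'⟩ := (isCompact_range hc).isBounded.exists_norm_le
    exact (h j).1.mul_bdd (c := K') hc.aestronglyMeasurable
      (Filter.Eventually.of_forall fun x => hK' _ ⟨x, rfl⟩)
  have i2 : ∀ j, Integrable fun x => g j x * φ x := fun j =>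
    (h j).2.1.mul_bdd (c := K) hφ.continuous.aestronglyMeasurable
      (Filter.Eventually.of_forall fun x => hK _ ⟨x, rfl⟩)
  rw [integral_finsetSum _ fun j _ => i1 j, Finset.sum_congr rfl fun j _ => (h j).2.2 φ hφ,
    Finset.sum_neg_distrib, ← integral_finsetSum _ fun j _ => i2 j]
  simp [← Finset.sum_mul, hg]

lemma memHolder_of_abs_sub_le {d : ℕ} {u : Torus d → Space d} {α : ℝ≥0}
    (h : ∀ j, ∃ K : ℝ, 0 ≤ K ∧ ∀ x y, |u x j - u y j| ≤ K * dist x y ^ (α : ℝ)) :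
    MemHolder α u := by
  choose K hK0 hK using h
  refine ⟨(∑ j, K j).toNNReal, fun x y => ?_⟩
  have hS : 0 ≤ ∑ j, K j := Finset.sum_nonneg fun j _ => hK0 j
  rw [edist_dist, edist_dist, ENNReal.ofReal_rpow_of_nonneg dist_nonneg α.coe_nonneg,
    ← ENNReal.ofReal_coe_nnreal, Real.coe_toNNReal _ hS, ← ENNReal.ofReal_mul hS]
  refine ENNReal.ofReal_le_ofReal ?_
  rw [dist_eq_norm, Finset.sum_mul]
  exact (norm_le_sum_abs _).trans (Finset.sum_le_sum fun j _ => hK j x y)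

/-- With `η = N ^ (-β)` one has `η * N = N ^ (-(β - 1))`, and the two ratios become `2 * N ^ (-(1 -
β * α))` and `2 ^ p * N ^ (-((β - 1) * (n + 2 - p)))`. Any `β` with `1 < β < 1 / α` makes all
exponents negative, and a large `N` then suffices. -/
lemma exists_parameters (n : ℕ) {p α : ℝ} (hpn : p < n + 2) (hα₀ : 0 < α) (hα₁ : α < 1) :
    ∃ (N : ℕ) (η : ℝ), 3 ≤ N ∧ 0 < η ∧ η * N ≤ 1 / 8 ∧
      (2 / (N : ℝ)) ^ (1 - α) * (2 / (N * η)) ^ α < 1 ∧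
      (2 / (N * η)) ^ p * (η * N) ^ (n + 2) < 1 := by
  obtain ⟨β, hβ1, hβα⟩ : ∃ β : ℝ, 1 < β ∧ β * α < 1 := by
    obtain ⟨β, h1, h2⟩ := exists_between (one_lt_one_div hα₀ hα₁)
    exact ⟨β, h1, by rwa [lt_div_iff₀ hα₀] at h2⟩
  have lim : ∀ {y : ℝ}, 0 < y → ∀ {ε : ℝ}, 0 < ε →
      ∀ᶠ N : ℕ in Filter.atTop, (N : ℝ) ^ (-y) < ε := fun hy _ hε =>
    ((tendsto_rpow_neg_atTop hy).comp tendsto_natCast_atTop_atTop).eventually (gt_mem_nhds hε)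
  obtain ⟨N, hN, h1, h2, h3⟩ := ((Filter.eventually_ge_atTop 3).and
    ((lim (sub_pos.2 hβ1) (by norm_num : (0 : ℝ) < 1 / 8)).and
    ((lim (sub_pos.2 hβα) (by norm_num : (0 : ℝ) < 1 / 2)).and
    (lim (mul_pos (sub_pos.2 hβ1) (sub_pos.2 hpn))
      (by positivity : (0 : ℝ) < 1 / 2 ^ p))))).exists
  have hN0 : (0 : ℝ) < N := by
    have : 0 < N := by omega
    exact_mod_cast this
  have e1 : (N : ℝ) ^ (-β) * N = N ^ (-(β - 1)) := by
    nth_rw 2 [← Real.rpow_one (N : ℝ)]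
    rw [← Real.rpow_add hN0]; congr 1; ring
  have e2 : 2 / ((N : ℝ) * N ^ (-β)) = 2 * N ^ (β - 1) := by
    rw [mul_comm, e1, Real.rpow_neg hN0.le, div_inv_eq_mul]
  refine ⟨N, (N : ℝ) ^ (-β), hN, by positivity, by rw [e1]; exact h1.le, ?_, ?_⟩
  · rw [e2, div_eq_mul_inv, ← Real.rpow_neg_one, Real.mul_rpow (by norm_num) (by positivity),
      Real.mul_rpow (by norm_num) (by positivity), ← Real.rpow_mul hN0.le, ← Real.rpow_mul hN0.le]
    calc (2 : ℝ) ^ (1 - α) * (N : ℝ) ^ (-1 * (1 - α)) * (2 ^ α * (N : ℝ) ^ ((β - 1) * α))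
        = (2 ^ (1 - α) * 2 ^ α) * ((N : ℝ) ^ (-1 * (1 - α)) * (N : ℝ) ^ ((β - 1) * α)) := by ring
      _ = 2 * (N : ℝ) ^ (-(1 - β * α)) := by
        rw [← Real.rpow_add hN0, ← Real.rpow_add (by norm_num : (0 : ℝ) < 2)]
        congr 1
        · norm_num
        · congr 1; ring
      _ < 1 := by linarith
  · rw [e1, e2, Real.mul_rpow (by norm_num) (by positivity), ← Real.rpow_natCast,
      ← Real.rpow_mul hN0.le, ← Real.rpow_mul hN0.le, mul_assoc, ← Real.rpow_add hN0]
    have e3 : (β - 1) * p + -(β - 1) * ((n + 2 : ℕ) : ℝ) = -((β - 1) * (n + 2 - p)) := by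
      push_cast; ring
    rw [e3]
    rwa [lt_div_iff₀ (by positivity), mul_comm] at h3

end SteadyFlow

end

/-! ### The theorem -/

theorem theorem2 (d : ℕ) (hd : 3 ≤ d) (p : ℝ) (hp : 1 ≤ p) (hpd : p < (d : ℝ) - 1)
    (α : ℝ≥0) (hα₀ : 0 < α) (hα₁ : α < 1) (T₀ : ℝ) (hT₀ : 0 < T₀) :
    ∃ u : SteadyFlow.Torus d → SteadyFlow.Space d,
      SteadyFlow.MemSobolev (ENNReal.ofReal p) u ∧
      MemHolder α u ∧
      SteadyFlow.IsDivergenceFree u ∧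
      ∀ T : ℝ, T₀ ≤ T → ∀ᵐ x : SteadyFlow.Torus d, x ∈ SteadyFlow.nonuniquenessSet u T := by
  open SteadyFlow in
  obtain ⟨n, rfl⟩ : ∃ n, d = n + 3 := ⟨d - 3, by omega⟩
  have hα₀' : (0 : ℝ) < α := by exact_mod_cast hα₀
  have hα₁' : (α : ℝ) < 1 := by exact_mod_cast hα₁
  obtain ⟨N, η, hN, hη, hηN, hal, hlr⟩ := exists_parameters n (p := p)
    (by push_cast at hpd; linarith) hα₀' hα₁'
  obtain ⟨C, hC⟩ := exists_isGeometric_generation n hN hη hηN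
  -- Two periods fit into `T₀`: at most one to reach an integral time, one more for the solutions to
  -- separate.
  set lam : ℝ := 2 / T₀ with hlam
  have hlam0 : 0 < lam := by positivity
  have hweak : ∀ i j : Fin (n + 3), HasWeakPartialDeriv j
      (fun x => steadyField n N η lam x i)
      (fun x => lam * ∑' k, generationDeriv N η k i j x) := fun i j =>
    ((hC i).hasWeakPartialDeriv_tsum j hp hlr).const_mul_const_add lam _
  refine ⟨steadyField n N η lam, ⟨?_, fun i j => ⟨_, ?_, hweak i j⟩⟩, ?_, ?_, fun T hT => ?_⟩
  · exact (continuous_steadyField hN hη hηN).memLp_of_hasCompactSupport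
      (HasCompactSupport.of_compactSpace _)
  · exact ((hC i).memLp_tsum_deriv j (by linarith) hlr).const_mul lam
  · refine memHolder_of_abs_sub_le fun j => ?_
    obtain ⟨K, hK0, hK⟩ := (hC j).exists_abs_sub_le_rpow hα₀'.le hα₁'.le hal
    refine ⟨lam * K, by positivity, fun x y => ?_⟩
    rw [steadyField_apply, steadyField_apply, ← mul_sub, add_sub_add_left_eq_sub, abs_mul,
      abs_of_pos hlam0, mul_assoc]
    exact mul_le_mul_of_nonneg_left (hK x y) hlam0.le
  · refine isDivergenceFree_of_hasWeakPartialDeriv (fun j => hweak j j) fun x => ?_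
    rw [← Finset.mul_sum, ← Summable.tsum_finsetSum fun j _ => (hC j).summable_deriv j x]
    simp [sum_generationDeriv]
  · refine Filter.Eventually.of_forall fun x => mem_nonuniquenessSet_steadyField hN hη hηN hlam0 ?_ x
    rw [hlam, div_div_cancel₀ two_ne_zero]
    exact hT
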